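/- Let $K$ be a field of characteristic $0$ and let $k\neq 1$ be an odd positive integer. Let $t=(t_1=x,t_3,\dots,t_{k-2},\bar t_k,t_{k+2},\dots)$. All functions of $(z,t)$ are formal power series over $K$, and $\partial=\partial_x$. For a pseudo-differential operator $P=\sum_{i\le N}a_i\partial^i$ with such coefficients, $P_+$ and $P_-$ are its parts with $i\ge 0$ and $i<0$, $P^*=\sum_i(-\partial)^ia_i$ is its formal adjoint, and $\operatorname{res}_\lambda\sum_i c_i\lambda^i=c_{-1}$. Let $L=\partial+\sum_{i\ge1}u_i\partial^{-i}$, $q$ and $r$, depending on $(z,t)$, be a solution of the extended BKP hierarchy with its auxiliary flow $\partial_z$. That is, with $B_n=(L^n)_+$, $$\partial_{\bar t_k}L=[B_k+r\partial^{-1}q_x-q\partial^{-1}r_x,\,L],\qquad \partial_{t_n}L=[B_n,L]\ (n\ne k \text{ odd}),\qquad L^*=-\partial L\partial^{-1},$$ $$\partial_zL=[r\partial^{-1}q_x-q\partial^{-1}r_x,\,L],$$ and $q,r$ are eigenfunctions: $q_{t_n}=B_n(q)$ and $r_{t_n}=B_n(r)$ for odd $n\neq k$, and $q_{\bar t_k}-q_z=B_k(q)$,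 $r_{\bar t_k}-r_z=B_k(r)$. Let $W=1+\sum_{i\ge1}w_i(z,t)\partial^{-i}$ be a dressing operator of this solution: $L=W\partial W^{-1}$, $W^*\partial W=\partial$, $\partial_{t_n}W=-(L^n)_-W$ for odd $n\ne k$, $\partial_{\bar t_k}W=-(L^k)_-W+(r\partial^{-1}q_x-q\partial^{-1}r_x)W$ and $\partial_zW=(r\partial^{-1}q_x-q\partial^{-1}r_x)W$. Let $w(z,t,\lambda)=We^{\xi(t,\lambda)}$ be the wave function, where $\xi(t,\lambda)=\bar t_k\lambda^k+\sum_{n\ne k,\ n\text{ odd}}t_n\lambda^n$ and $\partial^ie^{\xi}=\lambda^ie^{\xi}$ for all $i\in\mathbb Z$. Then the following identities hold as formal power series in the independent variables $z,t,t'$: $$\operatorname{res}_\lambda\lambda^{-1}w(z-\bar t_k,t,\lambda)\,w(z-\bar t_k',t',-\lambda)=1,$$ $$\operatorname{res}_\lambda\lambda^{-1}w_z(z-\bar t_k,t,\lambda)\,w(z-\bar t_k',t',-\lambda)=q(z-\bar t_k,t)\,r(z-\bar t_k',t')-r(z-\bar t_k,t)\,q(z-\bar t_k',t'),$$ $$q(z-\bar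 t_k,t)=\operatorname{res}_\lambda\lambda^{-1}w(z-\bar t_k,t,\lambda)\cdot\partial_{x'}^{-1}\big(q(z-\bar t_k',t')\,w_{x'}(z-\bar t_k',t',-\lambda)\big),$$ $$r(z-\bar t_k,t)=\operatorname{res}_\lambda\lambda^{-1}w(z-\bar t_k,t,\lambda)\cdot\partial_{x'}^{-1}\big(r(z-\bar t_k',t')\,w_{x'}(z-\bar t_k',t',-\lambda)\big).$$ Here $w_z(z-\bar t_k,t,\lambda)$ is $\partial_zw$ evaluated at $(z-\bar t_k,t,\lambda)$, and $\partial^{-1}(f\,w_x)$ denotes $(\partial^{-1}f\,\partial W)(e^{\xi(t,\lambda)})$, evaluated at the indicated arguments. -/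

import Mathlib

/-! Pseudo-differential operators, the extended BKP hierarchy and its wave function, with
coefficients that are formal power series in the (infinitely many) flow variables. -/

open scoped Differential

noncomputable section

namespace ExtBKP

/-! ### Pseudo-differential operators over a differential ring -/

/-- Formal pseudo-differential operators `∑_{i ≤ N} aᵢ ∂ⁱ` over a differential ring `(A, ′)`;
`coeff i` is `aᵢ`. -/
@[ext]
structure PDO (A : Type*) [Zero A] where
  coeff : ℤ → A
  bdd : ∃ N : ℤ, ∀ i, N < i → coeff i = 0

namespace PDO

variable {A : Type*} [CommRing A]

/-- The operator `a ∂ⁱ`. -/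
def monomial (i : ℤ) (a : A) : PDO A where
  coeff := fun j => if j = i then a else 0
  bdd := ⟨i, fun j hj => if_neg (by omega)⟩

/-- The operator of multiplication by `a`. -/
def C (a : A) : PDO A := monomial 0 a

/-- The operator `∂ⁱ`, for any integer `i`. -/
def D (i : ℤ) : PDO A := monomial i 1

instance : One (PDO A) := ⟨C 1⟩

instance : Add (PDO A) where
  add P Q :=
    { coeff := fun i => P.coeff i + Q.coeff i
      bdd := by
        obtain ⟨N, hN⟩ := P.bdd
        obtain ⟨M, hM⟩ := Q.bdd
        exact ⟨max N M, fun i hi => by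
          rw [hN i (lt_of_le_of_lt (le_max_left _ _) hi),
            hM i (lt_of_le_of_lt (le_max_right _ _) hi), add_zero]⟩ }

instance : Neg (PDO A) where
  neg P :=
    { coeff := fun i => -P.coeff i
      bdd := by
        obtain ⟨N, hN⟩ := P.bdd
        exact ⟨N, fun i hi => by rw [hN i hi, neg_zero]⟩ }

instance : Sub (PDO A) := ⟨fun P Q => P + -Q⟩

/-- The non-negative part `P₊ = ∑_{i ≥ 0} aᵢ ∂ⁱ`. -/
def pos (P : PDO A) : PDO A where
  coeff := fun i => if 0 ≤ i then P.coeff i else 0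
  bdd := by
    obtain ⟨N, hN⟩ := P.bdd
    exact ⟨N, fun i hi => by simp [hN i hi]⟩

/-- The negative part `P₋ = ∑_{i < 0} aᵢ ∂ⁱ`. -/
def neg (P : PDO A) : PDO A where
  coeff := fun i => if i < 0 then P.coeff i else 0
  bdd := by
    obtain ⟨N, hN⟩ := P.bdd
    exact ⟨N, fun i hi => by simp [hN i hi]⟩

variable [Differential A]

/-- The `l`-th derivative of a coefficient. -/
def iterDeriv (l : ℕ) (a : A) : A := (fun b : A => b′)^[l] a

theorem iterDeriv_zero (l : ℕ) : iterDeriv l (0 : A) = 0 := by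
  induction l with
  | zero => rfl
  | succ l ih => simp_all [iterDeriv, Function.iterate_succ_apply]

/-- Composition, from `∂ⁱ b = ∑_{l ≥ 0} (i choose l) b⁽ˡ⁾ ∂ⁱ⁻ˡ`: the coefficient of `∂ⁿ` in
`(∑ aᵢ ∂ⁱ)(∑ bⱼ ∂ʲ)` is the (finite) sum of `(i choose l) aᵢ bⱼ⁽ˡ⁾` over `i + j - l = n`. -/
instance : Mul (PDO A) where
  mul P Q :=
    { coeff := fun n => ∑ᶠ p : ℤ × ℕ,
        Ring.choose p.1 p.2 • (P.coeff p.1 * iterDeriv p.2 (Q.coeff (n + p.2 - p.1)))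
      bdd := by
        obtain ⟨N, hN⟩ := P.bdd
        obtain ⟨M, hM⟩ := Q.bdd
        refine ⟨N + M, fun n hn => finsum_eq_zero_of_forall_eq_zero fun p => ?_⟩
        by_cases hp : N < p.1
        · rw [hN _ hp, zero_mul, smul_zero]
        · rw [hM _ (by omega), iterDeriv_zero, mul_zero, smul_zero] }

/-- The sum defining a coefficient of a product has finitely many non-zero terms. -/
theorem mul_finite (P Q : PDO A) (n : ℤ) :
    (Function.support fun p : ℤ × ℕ => Ring.choose p.1 p.2 •
      (P.coeff p.1 * iterDeriv p.2 (Q.coeff (n + p.2 - p.1)))).Finite := by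
  obtain ⟨N, hN⟩ := P.bdd
  obtain ⟨M, hM⟩ := Q.bdd
  refine Set.Finite.subset
    (((Set.finite_Icc (n - M) N).prod (Set.finite_Iic (M - n + N).toNat))) fun p hp => ?_
  have h1 : p.1 ≤ N := by
    by_contra h
    exact hp (by simp only [hN _ (not_le.mp h), zero_mul, smul_zero])
  have h2 : n + p.2 - p.1 ≤ M := by
    by_contra h
    exact hp (by simp only [hM _ (not_le.mp h), iterDeriv_zero, mul_zero, smul_zero])
  simp only [Set.mem_prod, Set.mem_Icc, Set.mem_Iic]
  omega

instance : Pow (PDO A) ℕ := ⟨fun P n => npowRec n P⟩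

/-- The commutator `[P, Q] = PQ - QP`. -/
def comm (P Q : PDO A) : PDO A := P * Q - Q * P

/-- The formal adjoint `P* = ∑ (-∂)ⁱ aᵢ`, expanded: the coefficient of `∂ⁿ` is the (finite) sum
of `(-1)ⁱ (i choose l) aᵢ⁽ˡ⁾` over `i - l = n`. -/
def adjoint (P : PDO A) : PDO A where
  coeff := fun n => ∑ᶠ l : ℕ,
    (n + l).negOnePow • (Ring.choose (n + l) l • iterDeriv l (P.coeff (n + l)))
  bdd := by
    obtain ⟨N, hN⟩ := P.bdd
    refine ⟨N, fun n hn => finsum_eq_zero_of_forall_eq_zero fun l => ?_⟩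
    rw [hN _ (by omega), iterDeriv_zero, smul_zero, smul_zero]

/-- The action `P(f) = ∑_{i ≥ 0} aᵢ f⁽ⁱ⁾` of a differential operator on a function
(used only for operators without negative part). -/
def apply (P : PDO A) (f : A) : A := ∑ᶠ i : ℕ, P.coeff i * iterDeriv i f

end PDO

/-! ### Variables and formal functions -/

/-- The positive odd integers. -/
abbrev OddNat := {n : ℕ // Odd n}

/-- The variables `z, t₁ = x, t₃, t₅, …`. For the hierarchy with a fixed odd `k`, the variable
`t k` is the time `t̄ₖ` of the modified flow. -/
inductive Var
  | z
  | t (n : OddNat)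

/-- The variables `z, t₁, t₃, …, t₁', t₃', …` of the bilinear identities. -/
inductive BiVar
  | z
  | t (n : OddNat)
  | t' (n : OddNat)

/-- Functions of `(z, t)`: formal power series. -/
abbrev Fn (K : Type*) := MvPowerSeries Var K

/-- The variable `x = t₁`. -/
def Var.x : Var := Var.t ⟨1, odd_one⟩

variable {K : Type*} [Field K]

/-- `Fn K` is a differential ring with derivation `∂ = ∂/∂x`. -/
instance : Differential (Fn K) where
  deriv := @Derivation.mk ℤ (Fn K) (Fn K) _ _ _ (Ring.toIntAlgebra (Fn K)) _ _
    (MvPowerSeries.pderiv K Var.x : Fn K →+ Fn K).toIntLinearMap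
    ((MvPowerSeries.pderiv K Var.x).map_one_eq_zero)
    (fun a b => (MvPowerSeries.pderiv K Var.x).leibniz a b)

theorem fn_deriv_eq (f : Fn K) : f′ = MvPowerSeries.pderiv K Var.x f := rfl

/-- `∂/∂v` of an operator: differentiate all its coefficients. -/
def PDO.dvar (v : Var) (P : PDO (Fn K)) : PDO (Fn K) where
  coeff := fun i => MvPowerSeries.pderiv K v (P.coeff i)
  bdd := by
    obtain ⟨N, hN⟩ := P.bdd
    exact ⟨N, fun i hi => by rw [hN i hi, map_zero]⟩

/-! ### The extended BKP hierarchy -/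

/-- `Bₙ = (Lⁿ)₊`. -/
def B (L : PDO (Fn K)) (n : ℕ) : PDO (Fn K) := (L ^ n).pos

/-- The operator `r ∂⁻¹ qₓ - q ∂⁻¹ rₓ`. -/
def source (q r : Fn K) : PDO (Fn K) :=
  PDO.C r * PDO.D (-1) * PDO.C (q′) - PDO.C q * PDO.D (-1) * PDO.C (r′)

/-- `(L, q, r)`, depending on `(z, t)`, solves the extended BKP hierarchy with modified `k`-th flow
`∂_{t̄ₖ}` and auxiliary flow `∂_z`. The original `k`-th flow is `∂_{tₖ} = ∂_{t̄ₖ} - ∂_z`. -/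
structure IsExtendedBKP (k : OddNat) (L : PDO (Fn K)) (q r : Fn K) : Prop where
  /-- `L = ∂ + ∑_{i ≥ 1} uᵢ ∂⁻ⁱ` -/
  lead : L.coeff 1 = 1
  coeff_zero : L.coeff 0 = 0
  coeff_of_one_lt : ∀ i : ℤ, 1 < i → L.coeff i = 0
  /-- `∂_{t̄ₖ} L = [Bₖ + r ∂⁻¹ qₓ - q ∂⁻¹ rₓ, L]` -/
  flow_k : L.dvar (.t k) = PDO.comm (B L k + source q r) L
  /-- `L_{tₙ} = [Bₙ, L]` for `n ≠ k` -/
  flow_n : ∀ n : OddNat, n ≠ k → L.dvar (.t n) = PDO.comm (B L n) L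
  /-- `L* = -∂ L ∂⁻¹` -/
  constraint : L.adjoint = -(PDO.D 1 * L * PDO.D (-1))
  /-- `∂_z L = [r ∂⁻¹ qₓ - q ∂⁻¹ rₓ, L]` -/
  flow_z : L.dvar .z = PDO.comm (source q r) L
  /-- `q` is an eigenfunction: `q_{tₙ} = Bₙ(q)` -/
  q_n : ∀ n : OddNat, n ≠ k → MvPowerSeries.pderiv K (.t n) q = (B L n).apply q
  /-- `q_{tₖ} = Bₖ(q)` with `∂_{tₖ} = ∂_{t̄ₖ} - ∂_z` -/
  q_k : MvPowerSeries.pderiv K (.t k) q - MvPowerSeries.pderiv K .z q = (B L k).apply q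
  /-- `r` is an eigenfunction: `r_{tₙ} = Bₙ(r)` -/
  r_n : ∀ n : OddNat, n ≠ k → MvPowerSeries.pderiv K (.t n) r = (B L n).apply r
  /-- `r_{tₖ} = Bₖ(r)` with `∂_{tₖ} = ∂_{t̄ₖ} - ∂_z` -/
  r_k : MvPowerSeries.pderiv K (.t k) r - MvPowerSeries.pderiv K .z r = (B L k).apply r

/-- `W` is a dressing operator of the solution `(L, q, r)`. -/
structure IsDressing (k : OddNat) (L : PDO (Fn K)) (q r : Fn K) (W : PDO (Fn K)) : Prop where
  /-- `W = 1 + ∑_{i ≥ 1} wᵢ ∂⁻ⁱ` -/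
  lead : W.coeff 0 = 1
  coeff_of_pos : ∀ i : ℤ, 0 < i → W.coeff i = 0
  /-- `L = W ∂ W⁻¹` -/
  dress : ∃ V : PDO (Fn K), W * V = 1 ∧ V * W = 1 ∧ L = W * PDO.D 1 * V
  /-- `∂_{tₙ} W = -(Lⁿ)₋ W` for `n ≠ k` -/
  flow_n : ∀ n : OddNat, n ≠ k → W.dvar (.t n) = -(PDO.neg (L ^ (n : ℕ)) * W)
  /-- `∂_{t̄ₖ} W = -(Lᵏ)₋ W + (r ∂⁻¹ qₓ - q ∂⁻¹ rₓ) W` -/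
  flow_k : W.dvar (.t k) = -(PDO.neg (L ^ (k : ℕ)) * W) + source q r * W
  /-- `∂_z W = (r ∂⁻¹ qₓ - q ∂⁻¹ rₓ) W` -/
  flow_z : W.dvar .z = source q r * W
  /-- `W* ∂ W = ∂` -/
  constraint : W.adjoint * PDO.D 1 * W = PDO.D 1

/-! ### The spectral parameter and the wave function

Functions of `(z, t, λ)` are formal power series in the flow variables whose coefficients are
formal Laurent series in `λ⁻¹`: the variable of `LaurentSeries K` is `λ⁻¹`. -/

/-- `λⁱ`. -/
def lam (i : ℤ) : LaurentSeries K := HahnSeries.single (-i) 1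

/-- The residue `res_λ`, i.e. the coefficient of `λ⁻¹`. -/
def res {σ : Type*} (F : MvPowerSeries σ (LaurentSeries K)) : MvPowerSeries σ K :=
  fun M => HahnSeries.coeff (F M) 1

/-- The substitution `λ ↦ -λ`. -/
def negLam {σ : Type*} (F : MvPowerSeries σ (LaurentSeries K)) :
    MvPowerSeries σ (LaurentSeries K) := fun M =>
  { coeff := fun n => n.negOnePow • HahnSeries.coeff (F M) n
    isPWO_support' := (HahnSeries.isPWO_support (F M)).mono fun n hn h => hn (by
      simp only [h, smul_zero]) }

/-- `exp ξ(t, λ)` with `ξ(t, λ) = ∑_{n odd} tₙ λⁿ` (and `tₖ = t̄ₖ`), expanded as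
`∏ₙ ∑ₘ tₙᵐ λⁿᵐ / m!`; the variable `z` does not occur. -/
def expXi : MvPowerSeries Var (LaurentSeries K) := fun M =>
  M.prod fun v m => HahnSeries.C ((m.factorial : K)⁻¹) *
    (match v with
      | .z => (0 : LaurentSeries K)
      | .t n => lam (n : ℕ)) ^ m

/-- The symbol `∑ aᵢ λⁱ` of the operator `∑ aᵢ ∂ⁱ`. -/
def symbol (P : PDO (Fn K)) : MvPowerSeries Var (LaurentSeries K) := fun M =>
  HahnSeries.ofSuppBddBelow (fun n => MvPowerSeries.coeff M (P.coeff (-n))) (by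
    obtain ⟨N, hN⟩ := P.bdd
    refine ⟨-N, fun n hn => ?_⟩
    by_contra h
    exact hn (by simp only [hN (-n) (by omega), map_zero]))

/-- The action `P(exp ξ(t, λ))` of a pseudo-differential operator on the exponential, where
`∂ⁱ (exp ξ) = λⁱ exp ξ` for every integer `i`. -/
def actExp (P : PDO (Fn K)) : MvPowerSeries Var (LaurentSeries K) := symbol P * expXi

/-- The wave function `w(z, t, λ) = W exp ξ(t, λ)`. -/
def wave (W : PDO (Fn K)) : MvPowerSeries Var (LaurentSeries K) := actExp W

/-- `∂⁻¹(f wₓ)`, understood as `(∂⁻¹ f ∂ W)(exp ξ(t, λ))`. -/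
def invDx (f : Fn K) (W : PDO (Fn K)) : MvPowerSeries Var (LaurentSeries K) :=
  actExp (PDO.D (-1) * PDO.C f * PDO.D 1 * W)

/-! ### The shifted arguments -/

/-- The arguments `(z - t̄ₖ, t)`. -/
def shift (R : Type*) [CommRing R] (k : OddNat) : Var → MvPowerSeries BiVar R
  | .z => MvPowerSeries.X .z - MvPowerSeries.X (.t k)
  | .t n => MvPowerSeries.X (.t n)

/-- The arguments `(z - t̄ₖ', t')`. -/
def shift' (R : Type*) [CommRing R] (k : OddNat) : Var → MvPowerSeries BiVar R
  | .z => MvPowerSeries.X .z - MvPowerSeries.X (.t' k)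
  | .t n => MvPowerSeries.X (.t' n)

/-- `f(z - t̄ₖ, t)`. -/
def atT {R : Type*} [CommRing R] (k : OddNat) (f : MvPowerSeries Var R) : MvPowerSeries BiVar R :=
  MvPowerSeries.subst (shift R k) f

/-- `f(z - t̄ₖ', t')`. -/
def atT' {R : Type*} [CommRing R] (k : OddNat) (f : MvPowerSeries Var R) : MvPowerSeries BiVar R :=
  MvPowerSeries.subst (shift' R k) f

/-- The substitution of the shifted arguments into formal power series is well defined. -/
theorem hasSubst_shift (R : Type*) [CommRing R] (k : OddNat) :
    MvPowerSeries.HasSubst (shift R k) := by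
  classical
  refine ⟨fun s => ?_, fun d => ?_⟩
  · cases s <;> simp [shift]
  · refine Set.Finite.subset (((Set.finite_singleton Var.z)).union
      (Set.Finite.preimage (f := fun v : Var => match v with
        | .z => Finsupp.single BiVar.z 1
        | .t n => Finsupp.single (BiVar.t n) 1) ?_ (Set.finite_singleton d))) ?_
    · intro a ha b hb h
      simp only [Set.mem_preimage, Set.mem_singleton_iff] at ha hb
      have hab := ha.trans hb.symm
      cases a <;> cases b <;> first
        | rfl
        | (simp [Finsupp.single_left_inj] at hab; done)
        | (simp [Finsupp.single_left_inj] at hab; simp [hab])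
    · intro s hs
      cases s with
      | z => simp
      | t n =>
        right
        simp only [shift, MvPowerSeries.coeff_X, Set.mem_ofPred_eq, ne_eq, ite_eq_right_iff,
          Classical.not_imp] at hs
        simp [hs.1]

theorem hasSubst_shift' (R : Type*) [CommRing R] (k : OddNat) :
    MvPowerSeries.HasSubst (shift' R k) := by
  classical
  refine ⟨fun s => ?_, fun d => ?_⟩
  · cases s <;> simp [shift']
  · refine Set.Finite.subset (((Set.finite_singleton Var.z)).union
      (Set.Finite.preimage (f := fun v : Var => match v with
        | .z => Finsupp.single BiVar.z 1
        | .t n => Finsupp.single (BiVar.t' n) 1) ?_ (Set.finite_singleton d))) ?_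
    · intro a ha b hb h
      simp only [Set.mem_preimage, Set.mem_singleton_iff] at ha hb
      have hab := ha.trans hb.symm
      cases a <;> cases b <;> first
        | rfl
        | (simp [Finsupp.single_left_inj] at hab; done)
        | (simp [Finsupp.single_left_inj] at hab; simp [hab])
    · intro s hs
      cases s with
      | z => simp
      | t n =>
        right
        simp only [shift', MvPowerSeries.coeff_X, Set.mem_ofPred_eq, ne_eq, ite_eq_right_iff,
          Classical.not_imp] at hs
        simp [hs.1]

/-- Multiplication by `λ⁻¹` followed by the residue: `res_λ λ⁻¹ F G`. -/
def res₂ (F G : MvPowerSeries BiVar (LaurentSeries K)) : MvPowerSeries BiVar K :=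
  res (MvPowerSeries.C (lam (-1)) * F * G)

end ExtBKP

end

open ExtBKP

/-! The shift in the arguments undoes the modification of the hierarchy. Differentiating `f(z - t̄ₖ,
t)` in `t̄ₖ` gives `(∂_{t̄ₖ} - ∂_z) f` at the shifted point, and in `∂_{t̄ₖ} - ∂_z` the source term
`r ∂⁻¹ qₓ - q ∂⁻¹ rₓ` cancels. After the shift, `W` therefore evolves by `-(Lⁿ)₋ W` for every odd
`n`, so that `w` satisfies `w_{tₙ} = Bₙ w`, and `q`, `r` are eigenfunctions of all these flows
(`IsDressing.flowCoeff_add`, `pderiv_t_atT`).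

Each identity is then proved by Taylor expansion about the diagonal `t' = t`. The difference of its
two sides is placed in a family indexed by differential operators `P`, with `P` applied to the
factors in one set of times and `P = 1` giving the identity itself. A flow replaces `P` by `P_{tₙ} +
P Bₙ`, again a differential operator, so the family is closed under the flows in that set of times.
If every member vanishes on the diagonal, every member is zero (`eq_zero_of_diag_eq_zero`).

On the diagonal the exponentials cancel, because only odd flows occur, and the residue in `λ`
becomes a residue of operators: `res_λ λ⁻¹ P(e^ξ) Q(e^{-ξ})` is the coefficient of `∂⁻¹` in `P ∂⁻¹
Q*` (`res_actExp_mul`). Everything then collapses by `W ∂⁻¹ W* = ∂⁻¹`, a form of the BKP constraint.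
For an eigenfunction `f` there remains the residue of `P f ∂⁻¹`, which is `P(f)`. For `w_z` there
remains that of `(q ∂⁻¹ r - r ∂⁻¹ q) P*`, which is `q P(r) - r P(q)`.

The first identity is the eigenfunction identity for `f = 1`. The constant `1` is an eigenfunction
because `Lⁿ` has no constant term for odd `n`: the operator `Lⁿ ∂⁻¹ = W ∂ⁿ⁻¹ W*` is self-adjoint,
while the residue changes sign under the adjoint. -/

noncomputable section

namespace ExtBKP

namespace PDO

/-! ### Pseudo-differential operators: additive structure and order -/

section Additive

variable {A : Type*} [CommRing A]

instance : Zero (PDO A) := ⟨⟨fun _ => 0, 0, fun _ _ => rfl⟩⟩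

@[simp] theorem coeff_zero (i : ℤ) : (0 : PDO A).coeff i = 0 := rfl

@[simp] theorem coeff_add (P Q : PDO A) (i : ℤ) : (P + Q).coeff i = P.coeff i + Q.coeff i := rfl

@[simp] theorem coeff_neg (P : PDO A) (i : ℤ) : (-P).coeff i = -P.coeff i := rfl

@[simp] theorem coeff_sub (P Q : PDO A) (i : ℤ) : (P - Q).coeff i = P.coeff i - Q.coeff i :=
  (sub_eq_add_neg _ _).symm

theorem coeff_monomial (i j : ℤ) (a : A) :
    (monomial i a).coeff j = if j = i then a else 0 := rfl

theorem coeff_C (a : A) (j : ℤ) : (C a).coeff j = if j = 0 then a else 0 := rfl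

theorem coeff_D (i j : ℤ) : (D i : PDO A).coeff j = if j = i then 1 else 0 := rfl

theorem coeff_one (j : ℤ) : (1 : PDO A).coeff j = if j = 0 then 1 else 0 := rfl

theorem D_zero : (D 0 : PDO A) = 1 := rfl

theorem C_one : (C 1 : PDO A) = 1 := rfl

instance : AddCommGroup (PDO A) where
  add_assoc P Q R := by ext; simp [add_assoc]
  zero_add P := by ext; simp
  add_zero P := by ext; simp
  nsmul := nsmulRec
  neg_add_cancel P := by ext; simp
  zsmul := zsmulRec
  add_comm P Q := by ext; simp [add_comm]
  sub := Sub.sub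
  sub_eq_add_neg _ _ := rfl

/-- Taking a coefficient, as an additive map. -/
def coeffHom (i : ℤ) : PDO A →+ A where
  toFun P := P.coeff i
  map_zero' := rfl
  map_add' _ _ := rfl

@[simp] theorem coeffHom_apply (i : ℤ) (P : PDO A) : coeffHom i P = P.coeff i := rfl

/-- `P` has order at most `d`. -/
def OrderLE (P : PDO A) (d : ℤ) : Prop := ∀ i, d < i → P.coeff i = 0

theorem exists_orderLE (P : PDO A) : ∃ d, P.OrderLE d := P.bdd

theorem coeff_sum {ι : Type*} (s : Finset ι) (f : ι → PDO A) (i : ℤ) :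
    (∑ j ∈ s, f j).coeff i = ∑ j ∈ s, (f j).coeff i :=
  map_sum (coeffHom i) f s

/-- An additive map that kills all monomials and all operators of low order is zero. -/
theorem addMonoidHom_eq_zero {M : Type*} [AddCommGroup M] (φ : PDO A →+ M) (d : ℤ)
    (hd : ∀ P : PDO A, P.OrderLE d → φ P = 0) (hm : ∀ i a, φ (monomial i a) = 0) (P : PDO A) :
    φ P = 0 := by
  obtain ⟨N, hN⟩ := P.bdd
  -- Only finitely many terms of `P` lie above order `d`; removing them leaves an operator of order
  -- at most `d`.
  have key : (P - ∑ i ∈ Finset.Ioc d N, monomial i (P.coeff i)).OrderLE d := by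
    intro i hi
    simp only [coeff_sub, coeff_sum, coeff_monomial, Finset.sum_ite_eq, Finset.mem_Ioc]
    by_cases h : i ≤ N
    · simp [hi, h]
    · simp [h, hN i (not_le.mp h)]
  have := hd _ key
  rw [map_sub, map_sum, Finset.sum_eq_zero (fun i _ => hm i _), sub_zero] at this
  exact this

theorem orderLE_C (a : A) : (C a).OrderLE 0 := fun i hi => by
  rw [coeff_C, if_neg (by omega)]

theorem orderLE_D (j : ℤ) : (D j : PDO A).OrderLE j := fun i hi => by
  rw [coeff_D, if_neg (by omega)]

/-- Applying an additive map to all coefficients. -/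
def mapCoeff (δ : A →+ A) (P : PDO A) : PDO A where
  coeff := fun i => δ (P.coeff i)
  bdd := by
    obtain ⟨N, hN⟩ := P.bdd
    exact ⟨N, fun i hi => by rw [hN i hi, map_zero]⟩

@[simp] theorem coeff_mapCoeff (δ : A →+ A) (P : PDO A) (i : ℤ) :
    (mapCoeff δ P).coeff i = δ (P.coeff i) := rfl

end Additive

/-! ### Composition of operators and its associativity -/

variable {A : Type*} [CommRing A] [Differential A]

@[simp] theorem iterDeriv_zero_left (a : A) : iterDeriv 0 a = a := rfl

theorem iterDeriv_succ (l : ℕ) (a : A) : iterDeriv (l + 1) a = (iterDeriv l a)′ :=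
  Function.iterate_succ_apply' _ _ _

theorem iterDeriv_succ' (l : ℕ) (a : A) : iterDeriv (l + 1) a = iterDeriv l (a′) :=
  Function.iterate_succ_apply _ _ _

theorem iterDeriv_add (l : ℕ) (a b : A) :
    iterDeriv l (a + b) = iterDeriv l a + iterDeriv l b := by
  induction l with
  | zero => rfl
  | succ l ih => rw [iterDeriv_succ, iterDeriv_succ, iterDeriv_succ, ih, map_add]

theorem iterDeriv_one (l : ℕ) (hl : l ≠ 0) : iterDeriv l (1 : A) = 0 := by
  obtain ⟨m, rfl⟩ := Nat.exists_eq_succ_of_ne_zero hl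
  rw [Nat.succ_eq_add_one, iterDeriv_succ', Derivation.map_one_eq_zero, iterDeriv_zero]

theorem coeff_mul (P Q : PDO A) (n : ℤ) :
    (P * Q).coeff n = ∑ᶠ p : ℤ × ℕ,
      Ring.choose p.1 p.2 • (P.coeff p.1 * iterDeriv p.2 (Q.coeff (n + p.2 - p.1))) := rfl

theorem mul_add' (P Q R : PDO A) : P * (Q + R) = P * Q + P * R := by
  ext n
  rw [coeff_add, coeff_mul, coeff_mul, coeff_mul,
    ← finsum_add_distrib (mul_finite P Q n) (mul_finite P R n)]
  exact finsum_congr fun p => by rw [coeff_add, iterDeriv_add, mul_add, smul_add]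

theorem add_mul' (P Q R : PDO A) : (P + Q) * R = P * R + Q * R := by
  ext n
  rw [coeff_add, coeff_mul, coeff_mul, coeff_mul,
    ← finsum_add_distrib (mul_finite P R n) (mul_finite Q R n)]
  exact finsum_congr fun p => by rw [coeff_add, add_mul, smul_add]

instance : NonUnitalNonAssocRing (PDO A) where
  left_distrib := mul_add'
  right_distrib := add_mul'
  zero_mul P := by
    have h := add_mul' 0 0 P
    rwa [add_zero, left_eq_add] at h
  mul_zero P := by
    have h := mul_add' P 0 0
    rwa [add_zero, left_eq_add] at h

theorem OrderLE.mul {P Q : PDO A} {d e : ℤ} (hP : P.OrderLE d) (hQ : Q.OrderLE e) :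
    (P * Q).OrderLE (d + e) := fun n hn => by
  rw [coeff_mul]
  refine finsum_eq_zero_of_forall_eq_zero fun p => ?_
  by_cases hp : d < p.1
  · rw [hP _ hp, zero_mul, smul_zero]
  · rw [hQ _ (by omega), iterDeriv_zero, mul_zero, smul_zero]

theorem coeff_C_mul (a : A) (P : PDO A) (n : ℤ) : (C a * P).coeff n = a * P.coeff n := by
  rw [coeff_mul, finsum_eq_single _ ((0, 0) : ℤ × ℕ)]
  · simp [coeff_C]
  · rintro ⟨i, l⟩ h
    by_cases hi : i = 0
    · subst hi
      have hl : 0 < l := by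
        rcases Nat.eq_zero_or_pos l with rfl | h'
        · exact absurd rfl h
        · exact h'
      simp [Ring.choose_zero_pos ℤ hl]
    · simp [coeff_C, hi]

theorem coeff_mul_D (P : PDO A) (j n : ℤ) : (P * D j).coeff n = P.coeff (n - j) := by
  rw [coeff_mul, finsum_eq_single _ ((n - j, 0) : ℤ × ℕ)]
  · simp [coeff_D]
  · rintro ⟨i, l⟩ h
    simp only [coeff_D]
    split_ifs with hi
    · rw [iterDeriv_one, mul_zero, smul_zero]
      rintro rfl
      exact h (by simp; omega)
    · rw [iterDeriv_zero, mul_zero, smul_zero]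

theorem coeff_D_one_mul (P : PDO A) (n : ℤ) :
    (D 1 * P).coeff n = P.coeff (n - 1) + (P.coeff n)′ := by
  rw [coeff_mul, finsum_eq_sum_of_support_subset (s := {((1, 0) : ℤ × ℕ), (1, 1)})]
  · rw [Finset.sum_pair (by simp)]
    simp [coeff_D, iterDeriv_succ]
  · rintro ⟨i, l⟩ h
    by_cases hi : i = 1
    · subst hi
      by_cases hl : l ≤ 1
      · interval_cases l <;> simp
      · refine absurd ?_ h
        have h0 : Ring.choose (1 : ℤ) l = 0 := by
          have := Ring.choose_natCast (R := ℤ) 1 l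
          rw [Nat.choose_eq_zero_of_lt (by omega)] at this
          simpa using this
        simp [h0]
    · exact absurd (by simp [coeff_D, hi]) h

theorem D_mul_D (i j : ℤ) : (D i * D j : PDO A) = D (i + j) := by
  ext n
  rw [coeff_mul_D, coeff_D, coeff_D]
  exact if_congr (by omega) rfl rfl

theorem monomial_eq (i : ℤ) (a : A) : monomial i a = C a * D i := by
  ext n
  rw [coeff_C_mul, coeff_D, coeff_monomial, mul_ite, mul_one, mul_zero]

theorem one_mul' (P : PDO A) : 1 * P = P := by
  ext n
  rw [← C_one, coeff_C_mul, one_mul]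

theorem mul_one' (P : PDO A) : P * 1 = P := by
  ext n
  rw [← D_zero, coeff_mul_D, sub_zero]

theorem C_mul_C (a b : A) : (C a * C b : PDO A) = C (a * b) := by
  ext n
  rw [coeff_C_mul, coeff_C, coeff_C, mul_ite, mul_zero]

theorem map_iterDeriv (δ : A →+ A) (hc : ∀ a, δ (a′) = (δ a)′) (l : ℕ) (a : A) :
    δ (iterDeriv l a) = iterDeriv l (δ a) := by
  induction l with
  | zero => rfl
  | succ l ih => rw [iterDeriv_succ, iterDeriv_succ, hc, ih]

/-- A derivation commuting with `∂` acts as a derivation on operators. -/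
theorem mapCoeff_mul (δ : A →+ A) (hδ : ∀ a b, δ (a * b) = δ a * b + a * δ b)
    (hc : ∀ a, δ (a′) = (δ a)′) (P Q : PDO A) :
    mapCoeff δ (P * Q) = mapCoeff δ P * Q + P * mapCoeff δ Q := by
  ext n
  rw [coeff_add, coeff_mapCoeff, coeff_mul, coeff_mul, coeff_mul, δ.map_finsum (mul_finite P Q n),
    ← finsum_add_distrib (mul_finite _ Q n) (mul_finite P _ n)]
  refine finsum_congr fun p => ?_
  rw [map_zsmul, hδ, coeff_mapCoeff, coeff_mapCoeff, map_iterDeriv δ hc, smul_add]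

/-- The derivation of the coefficient ring, as an additive map. -/
def derivHom : A →+ A where
  toFun a := (a′)
  map_zero' := map_zero _
  map_add' := map_add _

theorem derivHom_mul (a b : A) : derivHom (a * b) = derivHom a * b + a * derivHom b := by
  have := Derivation.leibniz (Differential.deriv : Derivation ℤ A A) a b
  simp only [smul_eq_mul] at this
  change (a * b)′ = a′ * b + a * (b′)
  rw [this]; ring

theorem D_one_mul (P : PDO A) : D 1 * P = mapCoeff derivHom P + P * D 1 := by
  ext n
  rw [coeff_D_one_mul, coeff_add, coeff_mul_D, add_comm]
  rfl

/-- The reindexing by which Pascal's rule enters `mul_D_one_mul`. -/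
theorem finsum_prod_nat_eq_succ {M : Type*} [AddCommMonoid M] (G : ℤ × ℕ → M)
    (h : ∀ i, G (i, 0) = 0) : ∑ᶠ p, G p = ∑ᶠ p : ℤ × ℕ, G (p.1, p.2 + 1) := by
  have hinj : Function.Injective fun p : ℤ × ℕ => (p.1, p.2 + 1) := by
    rintro ⟨i, l⟩ ⟨j, m⟩ h
    simpa using h
  rw [← finsum_mem_range (f := G) hinj, ← finsum_mem_univ]
  refine finsum_mem_inter_support_eq _ _ _ ?_
  ext ⟨i, l⟩
  simp only [Set.univ_inter, Function.mem_support, Set.mem_inter_iff, Set.mem_range]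
  refine ⟨fun hG => ⟨?_, hG⟩, fun hG => hG.2⟩
  cases l with
  | zero => exact absurd (h i) hG
  | succ l => exact ⟨(i, l), rfl⟩

/-- This is Pascal's rule. With `∂ R = R′ + R ∂`, the binomial `(i+1 choose l)` coming from `Q ∂`
splits into `(i choose l)`, which gives `Q (R ∂)`, and a difference that gives `Q R′`. -/
theorem mul_D_one_mul (Q R : PDO A) : Q * D 1 * R = Q * (D 1 * R) := by
  ext n
  rw [D_one_mul, mul_add', coeff_add]
  have e1 : (Q * D 1 * R).coeff n = ∑ᶠ p : ℤ × ℕ, Ring.choose (p.1 + 1) p.2 •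
      (Q.coeff p.1 * iterDeriv p.2 (R.coeff (n - 1 + p.2 - p.1))) := by
    rw [coeff_mul, ← finsum_comp_equiv ((Equiv.addRight (1 : ℤ)).prodCongr (Equiv.refl ℕ))]
    refine finsum_congr fun p => ?_
    simp only [Equiv.prodCongr_apply, Equiv.coe_addRight, Equiv.coe_refl, Prod.map_fst,
      Prod.map_snd, id, coeff_mul_D, add_sub_cancel_right]
    congr 4
    omega
  have e2 : (Q * (R * D 1)).coeff n = ∑ᶠ p : ℤ × ℕ, Ring.choose p.1 p.2 •
      (Q.coeff p.1 * iterDeriv p.2 (R.coeff (n - 1 + p.2 - p.1))) := by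
    rw [coeff_mul]
    refine finsum_congr fun p => ?_
    rw [coeff_mul_D]
    congr 4
    omega
  have e3 : (Q * mapCoeff derivHom R).coeff n = ∑ᶠ p : ℤ × ℕ,
      (Ring.choose (p.1 + 1) p.2 - Ring.choose p.1 p.2) •
      (Q.coeff p.1 * iterDeriv p.2 (R.coeff (n - 1 + p.2 - p.1))) := by
    -- The `l = 0` term vanishes, both binomials being `1`; at `l + 1` the difference is `(i choose
    -- l)`.
    rw [finsum_prod_nat_eq_succ, coeff_mul]
    · refine finsum_congr fun p => ?_
      simp only [coeff_mapCoeff]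
      rw [Ring.choose_succ_succ, add_sub_cancel_right, iterDeriv_succ']
      rw [show n + (p.2 : ℤ) - p.1 = n - 1 + ((p.2 + 1 : ℕ) : ℤ) - p.1 by push_cast; omega]
      rfl
    · intro i
      simp
  have f2 := mul_finite Q R (n - 1)
  rw [e1, e2, e3, ← finsum_add_distrib _ f2]
  · exact finsum_congr fun p => by rw [← add_smul, sub_add_cancel]
  · refine (((f2.image fun p => (p.1, p.2)).union
      (mul_finite (Q * D 1) R n |>.image fun p => (p.1 - 1, p.2)))).subset fun p hp => ?_
    by_contra hcon
    simp only [Set.mem_union, Set.mem_image, Function.mem_support, not_or, not_exists, not_and,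
      not_imp_not] at hcon
    refine hp ?_
    have h1 := hcon.1 p
    have h2 := hcon.2 (p.1 + 1, p.2)
    simp only [Prod.mk.eta, add_sub_cancel_right,
      coeff_mul_D] at h1 h2
    have h3 := h2 trivial
    rw [show n + (p.2 : ℤ) - (p.1 + 1) = n - 1 + p.2 - p.1 by omega] at h3
    change (_ - _ : ℤ) • _ = _
    rw [sub_smul, h1 trivial, sub_zero, h3]

/-- The coefficient of `∂ⁱ⁺¹` in `∂ P` is `Pᵢ + Pᵢ₊₁′`, so a bound on the order of `P` can be
lowered by one indefinitely. -/
theorem D_one_mul_injective {P : PDO A} (h : D 1 * P = 0) : P = 0 := by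
  obtain ⟨N, hN⟩ := P.exists_orderLE
  have key : ∀ m : ℕ, P.OrderLE (N - m) := by
    intro m
    induction m with
    | zero => simpa using hN
    | succ m ih =>
      intro i hi
      have h1 := congrArg (fun R : PDO A => R.coeff (i + 1)) h
      simp only [coeff_D_one_mul, coeff_zero, add_sub_cancel_right] at h1
      rw [ih (i + 1) (by push_cast at hi; omega), map_zero, add_zero] at h1
      exact h1
  ext i
  exact key (N - i + 1).toNat i (by omega)

/-- `P` associates with all operators to its right. -/
def LeftAssoc (P : PDO A) : Prop := ∀ Q R : PDO A, P * Q * R = P * (Q * R)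

theorem LeftAssoc.mul {P P' : PDO A} (h : P.LeftAssoc) (h' : P'.LeftAssoc) :
    (P * P').LeftAssoc := fun Q R => by rw [h, h, h', ← h]

theorem leftAssoc_C (a : A) : (C a).LeftAssoc := fun Q R => by
  ext n
  rw [coeff_C_mul, coeff_mul, coeff_mul, mul_finsum' _ _ (mul_finite Q R n)]
  exact finsum_congr fun p => by rw [coeff_C_mul, mul_smul_comm, mul_assoc]

theorem mul_mul_D (Q R : PDO A) (j : ℤ) : Q * R * D j = Q * (R * D j) := by
  ext n
  rw [coeff_mul_D, coeff_mul, coeff_mul]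
  refine finsum_congr fun p => ?_
  rw [coeff_mul_D]
  congr 4
  omega

/-- The Leibniz rule for the coefficientwise derivative, combined with `∂ Q = Q′ + Q ∂`. -/
theorem leftAssoc_D_one : (D 1 : PDO A).LeftAssoc := fun Q R => by
  rw [D_one_mul, D_one_mul, mapCoeff_mul _ derivHom_mul (fun _ => rfl), add_mul', mul_D_one_mul,
    D_one_mul R, mul_add', mul_mul_D]
  abel

/-- No binomials of negative order are needed: both sides agree after left multiplication by `∂`,
which is injective and already associates. -/
theorem leftAssoc_D_neg_one : (D (-1) : PDO A).LeftAssoc := fun Q R => by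
  have hc : ∀ S : PDO A, D 1 * (D (-1) * S) = S := fun S => by
    rw [← leftAssoc_D_one, D_mul_D, add_neg_cancel, D_zero, one_mul']
  rw [← sub_eq_zero]
  apply D_one_mul_injective
  rw [mul_sub, hc, ← leftAssoc_D_one, hc, sub_self]

theorem D_mem_induction {S : PDO A → Prop} (hmul : ∀ P Q, S P → S Q → S (P * Q)) (h0 : S 1)
    (h1 : S (D 1)) (hn : S (D (-1))) (i : ℤ) : S (D i) := by
  induction i with
  | zero => exact h0
  | succ i ih =>
    rw [← D_mul_D]
    exact hmul _ _ ih h1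
  | pred i ih =>
    rw [sub_eq_add_neg, ← D_mul_D]
    exact hmul _ _ ih hn

theorem leftAssoc_monomial (i : ℤ) (a : A) : (monomial i a).LeftAssoc := by
  rw [monomial_eq]
  exact (leftAssoc_C a).mul (D_mem_induction (fun _ _ h h' => h.mul h') (leftAssoc_C 1)
    leftAssoc_D_one leftAssoc_D_neg_one i)

/-- Associativity holds when `P` is a monomial, and a fixed coefficient of either triple product
sees only finitely many terms of `P`. -/
theorem mul_assoc' (P Q R : PDO A) : P * Q * R = P * (Q * R) := by
  ext n
  obtain ⟨d, hd⟩ := Q.exists_orderLE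
  obtain ⟨e, he⟩ := R.exists_orderLE
  have := addMonoidHom_eq_zero ((coeffHom n).comp
    ((AddMonoidHom.mulRight R).comp (AddMonoidHom.mulRight Q) - AddMonoidHom.mulRight (Q * R)))
    -- For `P` of order at most `n - 1 - d - e` both products have order at most `n - 1`.
    (n - 1 - d - e) (fun P hP => ?_) (fun i a => ?_) P
  · simpa [sub_eq_zero] using this
  · have h1 := (hP.mul hd).mul he n (by omega)
    have h2 := hP.mul (hd.mul he) n (by omega)
    simp [h1, h2]
  · simp [leftAssoc_monomial i a Q R]

/-- The ring power is the power operation already used in `B`, so ring lemmas apply to `L ^ n`. -/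
instance : Ring (PDO A) where
  mul_assoc := mul_assoc'
  one_mul := one_mul'
  mul_one := mul_one'
  npow n P := P ^ n
  npow_zero _ := rfl
  npow_succ _ _ := rfl
  zsmul := zsmulRec
  neg_add_cancel := neg_add_cancel
  sub_eq_add_neg := sub_eq_add_neg

/-! ### The formal adjoint -/

theorem coeff_adjoint (P : PDO A) (n : ℤ) : P.adjoint.coeff n = ∑ᶠ l : ℕ,
    (n + l).negOnePow • (Ring.choose (n + l) l • iterDeriv l (P.coeff (n + l))) := rfl

theorem adjoint_finite (P : PDO A) (n : ℤ) : (Function.support fun l : ℕ =>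
    (n + l).negOnePow • (Ring.choose (n + l) l • iterDeriv l (P.coeff (n + l)))).Finite := by
  obtain ⟨N, hN⟩ := P.bdd
  refine (Set.finite_Iic (N - n).toNat).subset fun l hl => ?_
  by_contra h
  refine hl ?_
  simp only [Set.mem_Iic] at h
  simp only [hN (n + l) (by omega), iterDeriv_zero, smul_zero]

theorem adjoint_add (P Q : PDO A) : (P + Q).adjoint = P.adjoint + Q.adjoint := by
  ext n
  rw [coeff_add, coeff_adjoint, coeff_adjoint, coeff_adjoint,
    ← finsum_add_distrib (adjoint_finite P n) (adjoint_finite Q n)]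
  exact finsum_congr fun l => by rw [coeff_add, iterDeriv_add, smul_add, smul_add]

/-- The formal adjoint, as an additive map. -/
def adjointHom : PDO A →+ PDO A := AddMonoidHom.mk' adjoint adjoint_add

@[simp] theorem adjointHom_apply (P : PDO A) : adjointHom P = P.adjoint := rfl

theorem OrderLE.adjoint {P : PDO A} {d : ℤ} (hP : P.OrderLE d) : P.adjoint.OrderLE d :=
  fun n hn => by
    rw [coeff_adjoint]
    exact finsum_eq_zero_of_forall_eq_zero fun l => by
      rw [hP _ (by omega), iterDeriv_zero, smul_zero, smul_zero]

theorem coeff_D_mul_C (i n : ℤ) (b : A) : (D i * C b).coeff n =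
    if n ≤ i then Ring.choose i (i - n).toNat • iterDeriv (i - n).toNat b else 0 := by
  rw [coeff_mul]
  have hz : ∀ p : ℤ × ℕ, ¬ (p.1 = i ∧ n + p.2 = i) → Ring.choose p.1 p.2 •
      ((D i : PDO A).coeff p.1 * iterDeriv p.2 ((C b).coeff (n + p.2 - p.1))) = 0 := by
    intro p hp
    rw [coeff_D, coeff_C]
    by_cases h : p.1 = i
    · rw [if_neg (c := n + p.2 - p.1 = 0) (by omega), iterDeriv_zero, mul_zero, smul_zero]
    · rw [if_neg h, zero_mul, smul_zero]
  split_ifs with h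
  · rw [finsum_eq_single _ ((i, (i - n).toNat) : ℤ × ℕ)]
    · rw [coeff_D, coeff_C, if_pos rfl, if_pos (by simp; omega), one_mul]
    · rintro ⟨j, l⟩ hp
      apply hz
      rintro ⟨h1, h2⟩
      refine hp (Prod.ext h1 ?_)
      simp only at h2 ⊢
      omega
  · exact finsum_eq_zero_of_forall_eq_zero fun p => hz p (by omega)

theorem coeff_adjoint_monomial (i n : ℤ) (b : A) : (monomial i b).adjoint.coeff n =
    i.negOnePow • (D i * C b).coeff n := by
  rw [coeff_adjoint, coeff_D_mul_C]
  split_ifs with h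
  · rw [finsum_eq_single _ (i - n).toNat]
    · have : n + ((i - n).toNat : ℤ) = i := by omega
      rw [this, coeff_monomial, if_pos rfl]
    · intro l hl
      rw [coeff_monomial, if_neg (by omega), iterDeriv_zero, smul_zero, smul_zero]
  · rw [smul_zero]
    exact finsum_eq_zero_of_forall_eq_zero fun l => by
      rw [coeff_monomial, if_neg (by omega), iterDeriv_zero, smul_zero, smul_zero]

theorem coeff_zsmul (m : ℤ) (P : PDO A) (n : ℤ) : (m • P).coeff n = m • P.coeff n :=
  map_zsmul (coeffHom n) m P

/-- Ties the expanded coefficient formula of `adjoint` to the formal rule `(b ∂ⁱ)* = (-∂)ⁱ b`;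
binomials can then be avoided. -/
theorem adjoint_monomial (i : ℤ) (b : A) :
    (monomial i b).adjoint = (i.negOnePow : ℤ) • (D i * C b) := by
  ext n
  rw [coeff_adjoint_monomial, coeff_zsmul]
  rfl

/-- Two additive maps that do not raise the order by more than a constant are equal if they agree
on monomials. -/
theorem addMonoidHom_ext {φ ψ : PDO A →+ PDO A} (d : ℤ)
    (hφ : ∀ (P : PDO A) (e : ℤ), P.OrderLE e → (φ P).OrderLE (e + d))
    (hψ : ∀ (P : PDO A) (e : ℤ), P.OrderLE e → (ψ P).OrderLE (e + d))
    (h : ∀ i a, φ (monomial i a) = ψ (monomial i a)) (P : PDO A) : φ P = ψ P := by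
  ext n
  have := addMonoidHom_eq_zero ((coeffHom n).comp (φ - ψ)) (n - 1 - d) (fun P hP => ?_)
    (fun i a => ?_) P
  · simpa [sub_eq_zero] using this
  · simp [hφ P _ hP n (by omega), hψ P _ hP n (by omega)]
  · simp [h]

theorem adjoint_C (a : A) : (C a).adjoint = C a := by
  have := adjoint_monomial 0 a
  rw [D_zero, one_mul, Int.negOnePow_zero, Units.val_one, one_smul] at this
  exact this

theorem adjoint_D (i : ℤ) : (D i : PDO A).adjoint = (i.negOnePow : ℤ) • D i := by
  have := adjoint_monomial i (1 : A)
  rwa [C_one, mul_one] at this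

theorem adjoint_mul_D_one (Q : PDO A) : (Q * D 1).adjoint = -(D 1 * Q.adjoint) := by
  refine addMonoidHom_ext (φ := adjointHom.comp (AddMonoidHom.mulRight (D 1)))
    (ψ := -((AddMonoidHom.mulLeft (D 1)).comp adjointHom)) 1
    (fun P e hP => (hP.mul (orderLE_D 1)).adjoint) (fun P e hP i hi => ?_) (fun i a => ?_) Q
  · have := (orderLE_D 1).mul hP.adjoint i (by omega)
    simp [this]
  · have h : monomial i a * D 1 = monomial (i + 1) a := by
      rw [monomial_eq, monomial_eq, mul_assoc, D_mul_D]
    simp only [AddMonoidHom.comp_apply, AddMonoidHom.mulRight_apply, AddMonoidHom.neg_apply,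
      AddMonoidHom.coe_mulLeft, adjointHom_apply]
    rw [h, adjoint_monomial, adjoint_monomial, Int.negOnePow_succ, mul_smul_comm, ← mul_assoc,
      D_mul_D, add_comm 1 i, Units.val_neg, neg_smul]

theorem adjoint_mapCoeff (δ : A →+ A) (hc : ∀ a, δ (a′) = (δ a)′) (P : PDO A) :
    (mapCoeff δ P).adjoint = mapCoeff δ P.adjoint := by
  ext n
  rw [coeff_mapCoeff, coeff_adjoint, coeff_adjoint, δ.map_finsum (adjoint_finite P n)]
  refine finsum_congr fun l => ?_
  rw [Units.smul_def, Units.smul_def, map_zsmul, map_zsmul, map_iterDeriv δ hc, coeff_mapCoeff]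

/-- From `∂ Q = Q′ + Q ∂`: the adjoint is `(Q*)′ - ∂ Q*`, which is `-Q* ∂`. -/
theorem adjoint_D_one_mul (Q : PDO A) : (D 1 * Q).adjoint = Q.adjoint * (D 1).adjoint := by
  rw [D_one_mul, adjoint_add, adjoint_mul_D_one, adjoint_mapCoeff _ fun _ => rfl, D_one_mul,
    adjoint_D, Int.negOnePow_one, Units.val_neg, Units.val_one, neg_smul, one_smul, mul_neg]
  abel

theorem adjoint_D_neg_one_mul (Q : PDO A) :
    (D (-1) * Q).adjoint = Q.adjoint * (D (-1)).adjoint := by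
  have h := adjoint_D_one_mul (D (-1) * Q)
  rw [← mul_assoc, D_mul_D, add_neg_cancel, D_zero, one_mul, adjoint_D, Int.negOnePow_one,
    Units.val_neg, Units.val_one, neg_smul, one_smul] at h
  rw [h, adjoint_D, Int.negOnePow_neg, Int.negOnePow_one, Units.val_neg, Units.val_one, neg_smul,
    one_smul, mul_neg, mul_neg, neg_mul, neg_neg, mul_assoc, D_mul_D, add_neg_cancel, D_zero,
    mul_one]

theorem adjoint_C_mul (a : A) (Q : PDO A) : (C a * Q).adjoint = Q.adjoint * (C a).adjoint := by
  refine addMonoidHom_ext (φ := adjointHom.comp (AddMonoidHom.mulLeft (C a)))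
    (ψ := (AddMonoidHom.mulRight (C a).adjoint).comp adjointHom) 0
    (fun P e hP => ?_) (fun P e hP => hP.adjoint.mul (orderLE_C a).adjoint) (fun i b => ?_) Q
  · rw [add_comm]
    exact ((orderLE_C a).mul hP).adjoint
  · simp only [AddMonoidHom.comp_apply, AddMonoidHom.mulRight_apply, AddMonoidHom.coe_mulLeft,
      adjointHom_apply]
    have h : C a * monomial i b = monomial i (b * a) := by
      rw [monomial_eq, monomial_eq, ← mul_assoc, C_mul_C, mul_comm]
    rw [h, adjoint_monomial, adjoint_monomial, adjoint_C, smul_mul_assoc, mul_assoc, C_mul_C]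

/-- The rule is stable under products of the left factor and holds for multiplications and `∂^{±1}`,
hence for monomials; the order bound extends it to all operators. -/
theorem adjoint_mul (P Q : PDO A) : (P * Q).adjoint = Q.adjoint * P.adjoint := by
  obtain ⟨d, hd⟩ := Q.exists_orderLE
  refine addMonoidHom_ext (φ := adjointHom.comp (AddMonoidHom.mulRight Q))
    (ψ := (AddMonoidHom.mulLeft Q.adjoint).comp adjointHom) d
    (fun P e hP => (hP.mul hd).adjoint) (fun P e hP => ?_) (fun i a => ?_) P
  · rw [add_comm]
    exact hd.adjoint.mul hP.adjoint
  · let S : PDO A → Prop := fun P => ∀ Q : PDO A, (P * Q).adjoint = Q.adjoint * P.adjoint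
    have hS : ∀ P P', S P → S P' → S (P * P') := fun P P' h h' Q => by
      rw [mul_assoc, h, h', h, mul_assoc]
    have h1 : S (D i) := D_mem_induction hS (adjoint_C_mul 1) adjoint_D_one_mul
      adjoint_D_neg_one_mul i
    have h2 : S (monomial i a) := by
      rw [monomial_eq]
      exact hS _ _ (adjoint_C_mul a) h1
    exact h2 Q

theorem adjoint_adjoint (P : PDO A) : P.adjoint.adjoint = P := by
  refine addMonoidHom_ext (φ := adjointHom.comp adjointHom) (ψ := AddMonoidHom.id _) 0
    (fun P e hP => ?_) (fun P e hP => ?_) (fun i a => ?_) P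
  · rw [add_zero]
    exact hP.adjoint.adjoint
  · rw [add_zero]
    exact hP
  · simp only [AddMonoidHom.comp_apply, adjointHom_apply, AddMonoidHom.id_apply]
    rw [adjoint_monomial, ← adjointHom_apply, map_zsmul, adjointHom_apply, adjoint_mul, adjoint_C,
      adjoint_D, mul_smul_comm, smul_smul, ← monomial_eq, ← Units.val_mul,
      Int.units_mul_self, Units.val_one, one_smul]

/-- The residue of the adjoint. -/
theorem coeff_neg_one_adjoint (P : PDO A) : P.adjoint.coeff (-1) = -P.coeff (-1) := by
  rw [coeff_adjoint, finsum_eq_single _ 0]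
  · simp
  · intro l hl
    obtain ⟨m, rfl⟩ := Nat.exists_eq_succ_of_ne_zero hl
    -- For `l = m + 1` the exponent `l - 1 = m` is a natural number below `l`, so only `l = 0`
    -- contributes.
    have : Ring.choose (-1 + ((m.succ : ℕ) : ℤ)) m.succ = 0 := by
      have h := Ring.choose_natCast (R := ℤ) m m.succ
      rw [Nat.choose_succ_self] at h
      simpa using h
    rw [this, zero_smul, smul_zero]

end PDO

/-! ### Partial derivatives and substitutions of power series -/

section PowerSeries

open MvPowerSeries

theorem pderiv_pderiv_comm {σ R : Type*} [CommRing R] (v w : σ) (f : MvPowerSeries σ R) :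
    pderiv R v (pderiv R w f) = pderiv R w (pderiv R v f) := by
  classical
  ext n
  simp only [coeff_pderiv, add_right_comm n (Finsupp.single w 1) (Finsupp.single v 1),
    Finsupp.add_apply, Finsupp.single_apply]
  by_cases h : v = w
  · subst h; ring
  · rw [if_neg h, if_neg (Ne.symm h)]
    push_cast
    ring

open scoped MvPowerSeries.WithPiTopology in
theorem continuous_pderiv {σ R : Type*} [CommRing R] [TopologicalSpace R] [DiscreteTopology R]
    (v : σ) : Continuous (pderiv R v : MvPowerSeries σ R → MvPowerSeries σ R) := by
  refine continuous_pi fun n => ?_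
  have := (continuous_of_discreteTopology (f := fun r : R => r * ((n v : R) + 1))).comp
    (WithPiTopology.continuous_coeff R (n + Finsupp.single v 1))
  convert this using 2 with f
  exact coeff_pderiv f n

open scoped MvPowerSeries.WithPiTopology in
/-- The chain rule for the substitution of power series, if only finitely many of them depend on
the variable in question. -/
theorem pderiv_subst {σ τ R : Type*} [CommRing R] {a : σ → MvPowerSeries τ R} (ha : HasSubst a)
    (v : τ) (S : Finset σ) (hS : ∀ s ∉ S, pderiv R v (a s) = 0) (f : MvPowerSeries σ R) :
    pderiv R v (subst a f) = ∑ s ∈ S, pderiv R v (a s) * subst a (pderiv R s f) := by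
  classical
  -- With discrete coefficients both sides are continuous and polynomials are dense, so the rule
  -- need only be checked on polynomials.
  let : UniformSpace R := ⊥
  have : DiscreteUniformity R := ⟨rfl⟩
  have hsub : Continuous (subst a : MvPowerSeries σ R → MvPowerSeries τ R) := continuous_subst ha
  have hl : Continuous fun f : MvPowerSeries σ R => pderiv R v (subst a f) :=
    (continuous_pderiv v).comp hsub
  have hr : Continuous fun f : MvPowerSeries σ R =>
      ∑ s ∈ S, pderiv R v (a s) * subst a (pderiv R s f) :=
    continuous_finsetSum _ fun s _ => continuous_const.mul (hsub.comp (continuous_pderiv s))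
  refine congrFun (DenseRange.equalizer WithPiTopology.denseRange_toMvPowerSeries hl hr
    (funext fun p => ?_)) f
  simp only [Function.comp_apply]
  induction p using MvPolynomial.induction_on with
  | C r =>
    have h0 : subst a (0 : MvPowerSeries σ R) = 0 := by rw [← coe_substAlgHom ha, map_zero]
    simp [subst_C, h0]
  | add p q hp hq =>
    rw [MvPolynomial.coe_add, subst_add ha, map_add, hp, hq, ← Finset.sum_add_distrib]
    refine Finset.sum_congr rfl fun s _ => ?_
    rw [map_add, subst_add ha, mul_add]
  | mul_X p t hp =>
    have hX : ∀ s, subst a (pderiv R s (X t)) = if s = t then 1 else 0 := fun s => by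
      split_ifs with h
      · subst h
        rw [pderiv_X_self, ← coe_substAlgHom ha, map_one]
      · rw [pderiv_X_of_ne (Ne.symm h), ← coe_substAlgHom ha, map_zero]
    rw [MvPolynomial.coe_mul, MvPolynomial.coe_X, subst_mul ha, subst_X ha, Derivation.leibniz, hp]
    simp only [Derivation.leibniz, subst_add ha, smul_eq_mul, subst_mul ha, hX, subst_X ha, mul_add,
      Finset.sum_add_distrib, mul_ite, mul_one, mul_zero, Finset.sum_ite_eq', Finset.mul_sum]
    congr 1
    · split_ifs with h
      · ring
      · rw [hS t h, mul_zero]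
    · exact Finset.sum_congr rfl fun s _ => by ring

/-- A power series over a ring without additive torsion is zero if all its iterated partial
derivatives have zero constant term. -/
theorem eq_zero_of_pderiv_closed {σ R : Type*} [CommRing R] [IsAddTorsionFree R]
    (S : Set (MvPowerSeries σ R)) (hS : ∀ v, ∀ f ∈ S, pderiv R v f ∈ S)
    (h0 : ∀ f ∈ S, constantCoeff f = 0) {f : MvPowerSeries σ R} (hf : f ∈ S) : f = 0 := by
  have key : ∀ (d : ℕ) (n : σ →₀ ℕ), n.degree = d → ∀ f ∈ S, coeff n f = 0 := by
    intro d
    induction d with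
    | zero =>
      intro n hn f hf
      rw [Finsupp.degree_eq_zero_iff] at hn
      rw [hn]
      exact h0 f hf
    | succ d ih =>
      intro n hn f hf
      obtain ⟨v, hv⟩ : ∃ v, n v ≠ 0 := by
        by_contra! h
        rw [(Finsupp.ext h : n = 0)] at hn
        simp at hn
      have hle : Finsupp.single v 1 ≤ n := by
        rw [Finsupp.single_le_iff]
        exact Nat.one_le_iff_ne_zero.mpr hv
      have hd : (n - Finsupp.single v 1).degree = d := by
        have := congrArg Finsupp.degree (tsub_add_cancel_of_le hle)
        rw [map_add, Finsupp.degree_single, hn] at this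
        omega
      have h1 := ih _ hd _ (hS v f hf)
      rw [coeff_pderiv, tsub_add_cancel_of_le hle] at h1
      -- The coefficient of `∂_v f` one degree lower is `n v` times that of `f`; the missing torsion
      -- allows division by `n v ≠ 0`.
      have h2 : ((n v : ℕ) : ℕ) • coeff n f = 0 := by
        rw [nsmul_eq_mul, mul_comm, ← h1]
        congr 1
        rw [Finsupp.tsub_apply, Finsupp.single_eq_same, Nat.cast_sub (by omega), Nat.cast_one,
          sub_add_cancel]
      exact (smul_eq_zero_iff_right hv).mp h2
  ext n
  exact key _ n rfl f hf

end PowerSeries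

/-! ### Residues and the spectral parameter -/

section Spectral

variable {K : Type*} [Field K]

theorem coeff_res {σ : Type*} (F : MvPowerSeries σ (LaurentSeries K)) (M : σ →₀ ℕ) :
    MvPowerSeries.coeff M (res F) = (MvPowerSeries.coeff M F).coeff 1 := rfl

/-- The residue, as an additive map. -/
def resHom {σ : Type*} : MvPowerSeries σ (LaurentSeries K) →+ MvPowerSeries σ K where
  toFun := res
  map_zero' := rfl
  map_add' _ _ := rfl

@[simp] theorem resHom_apply {σ : Type*} (F : MvPowerSeries σ (LaurentSeries K)) :
    resHom F = res F := rfl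

theorem res_add {σ : Type*} (F G : MvPowerSeries σ (LaurentSeries K)) :
    res (F + G) = res F + res G := rfl

theorem res_pderiv {σ : Type*} (v : σ) (F : MvPowerSeries σ (LaurentSeries K)) :
    res (MvPowerSeries.pderiv _ v F) = MvPowerSeries.pderiv K v (res F) := by
  ext M
  rw [coeff_res, MvPowerSeries.coeff_pderiv, MvPowerSeries.coeff_pderiv, coeff_res, mul_comm,
    mul_comm _ ((M v : K) + 1), ← Nat.cast_succ, ← Nat.cast_succ, ← nsmul_eq_mul, ← nsmul_eq_mul]
  exact map_nsmul (HahnSeries.coeff.addMonoidHom (1 : ℤ)) _ _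

/-- The residue commutes with the substitution of power series not containing `λ`. -/
theorem res_subst {σ τ : Type*} {a : σ → MvPowerSeries τ K} (ha : MvPowerSeries.HasSubst a)
    (F : MvPowerSeries σ (LaurentSeries K)) :
    res (MvPowerSeries.subst (fun s => MvPowerSeries.map HahnSeries.C (a s)) F) =
      MvPowerSeries.subst a (res F) := by
  ext e
  have hb : MvPowerSeries.HasSubst
      (fun s => MvPowerSeries.map (HahnSeries.C : K →+* LaurentSeries K) (a s)) := ha.map _
  have hfin := MvPowerSeries.coeff_subst_finite hb F e
  rw [coeff_res, MvPowerSeries.coeff_subst hb, MvPowerSeries.coeff_subst ha]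
  refine ((HahnSeries.coeff.addMonoidHom (R := K) (1 : ℤ)).map_finsum hfin).trans
    (finsum_congr fun d => ?_)
  have hd : (d.prod fun s m =>
      (MvPowerSeries.map (HahnSeries.C : K →+* LaurentSeries K) (a s)) ^ m) =
      MvPowerSeries.map HahnSeries.C (d.prod fun s m => a s ^ m) := by
    rw [map_finsuppProd]
    simp only [map_pow]
  rw [hd, MvPowerSeries.coeff_map, smul_eq_mul, mul_comm, HahnSeries.C_mul_eq_smul,
    HahnSeries.coeff.addMonoidHom_apply, HahnSeries.coeff_smul, smul_eq_mul, smul_eq_mul, coeff_res,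
    mul_comm]

/-- The substitution `λ ↦ -λ` on Laurent series. -/
def negLamHom : LaurentSeries K →+* LaurentSeries K where
  toFun f :=
    { coeff := fun n => n.negOnePow • f.coeff n
      isPWO_support' := f.isPWO_support.mono fun n hn h => hn (by simp only [h, smul_zero]) }
  map_one' := by
    ext n
    by_cases h : n = 0
    · subst h; simp
    · simp [HahnSeries.coeff_one, h]
  map_mul' f g := by
    ext n
    change n.negOnePow • (f * g).coeff n = _
    rw [HahnSeries.coeff_mul, HahnSeries.coeff_mul, Finset.smul_sum]
    refine Finset.sum_congr ?_ fun p hp => ?_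
    · ext p
      simp [Finset.mem_antidiagonal, smul_eq_zero_iff_eq]
    · have h : p.1 + p.2 = n := by simp at hp; exact hp.2.2
      rw [smul_mul_smul_comm, ← Int.negOnePow_add, h]
  map_zero' := by ext n; simp
  map_add' f g := by ext n; simp

theorem coeff_negLamHom (f : LaurentSeries K) (n : ℤ) :
    (negLamHom f).coeff n = n.negOnePow • f.coeff n := rfl

theorem negLam_eq {σ : Type*} (F : MvPowerSeries σ (LaurentSeries K)) :
    negLam F = MvPowerSeries.map negLamHom F := rfl

theorem negLam_mul {σ : Type*} (F G : MvPowerSeries σ (LaurentSeries K)) :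
    negLam (F * G) = negLam F * negLam G := map_mul (MvPowerSeries.map negLamHom) F G

theorem negLam_add {σ : Type*} (F G : MvPowerSeries σ (LaurentSeries K)) :
    negLam (F + G) = negLam F + negLam G := map_add (MvPowerSeries.map negLamHom) F G

theorem negLam_sub {σ : Type*} (F G : MvPowerSeries σ (LaurentSeries K)) :
    negLam (F - G) = negLam F - negLam G := map_sub (MvPowerSeries.map negLamHom) F G

theorem negLamHom_lam (i : ℤ) : negLamHom (lam i : LaurentSeries K) =
    (i.negOnePow : ℤ) • lam i := by
  ext n
  rw [coeff_negLamHom, lam, HahnSeries.coeff_smul]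
  by_cases h : n = -i
  · rw [h, Int.negOnePow_neg]; rfl
  · rw [HahnSeries.coeff_single_of_ne h, smul_zero, smul_zero]

theorem pderiv_negLam {σ : Type*} (v : σ) (F : MvPowerSeries σ (LaurentSeries K)) :
    MvPowerSeries.pderiv _ v (negLam F) = negLam (MvPowerSeries.pderiv _ v F) := by
  ext1 M
  rw [negLam_eq, negLam_eq, MvPowerSeries.coeff_pderiv, MvPowerSeries.coeff_map,
    MvPowerSeries.coeff_map, MvPowerSeries.coeff_pderiv, map_mul, map_add, map_natCast, map_one]

theorem lam_mul_lam (i j : ℤ) : (lam i * lam j : LaurentSeries K) = lam (i + j) := by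
  rw [lam, lam, lam, HahnSeries.single_mul_single, one_mul, neg_add]

/-- The exponent of `exp ξ` in the direction of a variable. -/
def xiCoeff : Var → LaurentSeries K
  | .z => 0
  | .t n => lam (n : ℕ)

theorem coeff_expXi (M : Var →₀ ℕ) : MvPowerSeries.coeff M (expXi (K := K)) =
    M.prod fun v m => HahnSeries.C ((m.factorial : K)⁻¹) * xiCoeff v ^ m := rfl

/-- Only odd powers of `λ` occur in `ξ`, so `ξ(t, -λ) = -ξ(t, λ)`. -/
theorem negLamHom_xiCoeff (v : Var) : negLamHom (xiCoeff (K := K) v) = -xiCoeff v := by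
  cases v with
  | z => exact (map_zero _).trans neg_zero.symm
  | t n =>
    rw [xiCoeff, negLamHom_lam, Int.negOnePow_odd _ (by exact_mod_cast n.2), Units.val_neg,
      Units.val_one, neg_smul, one_smul]

theorem pderiv_expXi [CharZero K] (v : Var) : MvPowerSeries.pderiv _ v (expXi (K := K)) =
    MvPowerSeries.C (xiCoeff v) * expXi := by
  ext1 M
  have hg : ∀ w : Var, HahnSeries.C (((0 : ℕ).factorial : K)⁻¹) * xiCoeff (K := K) w ^ 0 = 1 := by
    intro w
    simp
  have he : (M + Finsupp.single v 1).erase v = M.erase v := by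
    rw [Finsupp.erase_add, Finsupp.erase_single, add_zero]
  rw [MvPowerSeries.coeff_pderiv, MvPowerSeries.coeff_C_mul, coeff_expXi, coeff_expXi,
    ← Finsupp.mul_prod_erase' _ v _ hg, ← Finsupp.mul_prod_erase' M v _ hg, he]
  have hf : (HahnSeries.C (((M v + 1).factorial : K)⁻¹) : LaurentSeries K) *
      ((M v : LaurentSeries K) + 1) =
      HahnSeries.C (((M v).factorial : K)⁻¹) := by
    have h1 : ((M v : LaurentSeries K) + 1) = HahnSeries.C ((M v : K) + 1) := by
      rw [map_add, map_natCast, map_one]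
    have h2 : ((M v : K) + 1) ≠ 0 := Nat.cast_add_one_ne_zero _
    rw [h1, ← map_mul, Nat.factorial_succ, Nat.cast_mul, Nat.cast_succ, mul_inv_rev, mul_assoc,
      inv_mul_cancel₀ h2, mul_one]
  rw [Finsupp.add_apply, Finsupp.single_eq_same, pow_succ, ← hf]
  ring

instance [CharZero K] : IsAddTorsionFree (LaurentSeries K) :=
  IsAddTorsionFree.of_module_rat _

theorem constantCoeff_expXi : MvPowerSeries.constantCoeff (expXi (K := K)) = 1 :=
  Finsupp.prod_zero_index (h := fun v m => HahnSeries.C ((m.factorial : K)⁻¹) * xiCoeff v ^ m)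

/-- All partial derivatives of the product cancel and its constant term is `1`; in characteristic
zero this determines it. -/
theorem expXi_mul_negLam [CharZero K] : (expXi (K := K)) * negLam expXi = 1 := by
  refine MvPowerSeries.pderiv.ext (fun v => ?_) ?_
  · rw [Derivation.leibniz, pderiv_negLam, pderiv_expXi, negLam_mul, Derivation.map_one_eq_zero,
      negLam_eq (MvPowerSeries.C _), MvPowerSeries.map_C, negLamHom_xiCoeff, smul_eq_mul,
      smul_eq_mul, map_neg]
    ring
  · rw [map_mul, map_one, constantCoeff_expXi, one_mul, negLam_eq,
      MvPowerSeries.constantCoeff_map, constantCoeff_expXi, map_one]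

/-! ### Symbols and the residue formula -/

theorem coeff_symbol (P : PDO (Fn K)) (M : Var →₀ ℕ) (n : ℤ) :
    (MvPowerSeries.coeff M (symbol P)).coeff n = MvPowerSeries.coeff M (P.coeff (-n)) := rfl

/-- The symbol, as an additive map. -/
def symbolHom : PDO (Fn K) →+ MvPowerSeries Var (LaurentSeries K) where
  toFun := symbol
  map_zero' := rfl
  map_add' _ _ := rfl

@[simp] theorem symbolHom_apply (P : PDO (Fn K)) : symbolHom P = symbol P := rfl

theorem symbol_add (P Q : PDO (Fn K)) : symbol (P + Q) = symbol P + symbol Q := rfl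

theorem symbol_mul_D (P : PDO (Fn K)) (i : ℤ) :
    symbol (P * PDO.D i) = MvPowerSeries.C (lam i) * symbol P := by
  ext M n
  rw [MvPowerSeries.coeff_C_mul, coeff_symbol, PDO.coeff_mul_D, lam, HahnSeries.coeff_single_mul,
    one_mul, coeff_symbol]
  congr 2
  ring

theorem symbol_C (a : Fn K) : symbol (PDO.C a) = MvPowerSeries.map HahnSeries.C a := by
  ext M n
  rw [coeff_symbol, PDO.coeff_C, MvPowerSeries.coeff_map, HahnSeries.C_apply]
  by_cases h : n = 0
  · subst h; simp
  · rw [if_neg (by omega), HahnSeries.coeff_single_of_ne h, map_zero]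

theorem pderiv_symbol (v : Var) (P : PDO (Fn K)) :
    MvPowerSeries.pderiv _ v (symbol P) = symbol (P.dvar v) := by
  ext M n
  rw [MvPowerSeries.coeff_pderiv, coeff_symbol, PDO.dvar, MvPowerSeries.coeff_pderiv, mul_comm,
    mul_comm _ ((M v : K) + 1), ← Nat.cast_succ, ← Nat.cast_succ, ← nsmul_eq_mul, ← nsmul_eq_mul]
  exact map_nsmul (HahnSeries.coeff.addMonoidHom n) _ _

theorem actExp_add (P Q : PDO (Fn K)) : actExp (P + Q) = actExp P + actExp Q := by
  rw [actExp, symbol_add, add_mul]; rfl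

theorem actExp_sub (P Q : PDO (Fn K)) : actExp (P - Q) = actExp P - actExp Q := by
  rw [eq_sub_iff_add_eq, ← actExp_add, sub_add_cancel]

theorem pderiv_z_actExp [CharZero K] (P : PDO (Fn K)) :
    MvPowerSeries.pderiv _ .z (actExp P) = actExp (P.dvar .z) := by
  rw [actExp, Derivation.leibniz, pderiv_expXi, pderiv_symbol, xiCoeff, map_zero, zero_mul,
    smul_zero, zero_add, smul_eq_mul, mul_comm]
  rfl

theorem pderiv_t_actExp [CharZero K] (n : OddNat) (P : PDO (Fn K)) :
    MvPowerSeries.pderiv _ (.t n) (actExp P) = actExp (P.dvar (.t n) + P * PDO.D (n : ℕ)) := by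
  rw [actExp, Derivation.leibniz, pderiv_expXi, pderiv_symbol, xiCoeff, actExp, symbol_add,
    symbol_mul_D, smul_eq_mul, smul_eq_mul]
  ring

/-- The coefficients of `F` have degree at most `d` in `λ`. -/
def LamOrderLE {σ : Type*} (F : MvPowerSeries σ (LaurentSeries K)) (d : ℤ) : Prop :=
  ∀ M n, n < -d → (MvPowerSeries.coeff M F).coeff n = 0

theorem LamOrderLE.mul {σ : Type*} {F G : MvPowerSeries σ (LaurentSeries K)} {d e : ℤ}
    (hF : LamOrderLE F d) (hG : LamOrderLE G e) : LamOrderLE (F * G) (d + e) := by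
  classical
  intro M n hn
  rw [MvPowerSeries.coeff_mul]
  refine (map_sum (HahnSeries.coeff.addMonoidHom n) _ _).trans (Finset.sum_eq_zero fun p _ => ?_)
  rw [HahnSeries.coeff.addMonoidHom_apply, HahnSeries.coeff_mul]
  refine Finset.sum_eq_zero fun ij hij => ?_
  have h : ij.1 + ij.2 = n := by simp at hij; exact hij.2.2
  by_cases h1 : ij.1 < -d
  · rw [hF _ _ h1, zero_mul]
  · rw [hG _ _ (by omega), mul_zero]

theorem LamOrderLE.negLam {σ : Type*} {F : MvPowerSeries σ (LaurentSeries K)} {d : ℤ}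
    (hF : LamOrderLE F d) : LamOrderLE (negLam F) d := fun M n hn => by
  rw [negLam_eq, MvPowerSeries.coeff_map, coeff_negLamHom, hF _ _ hn, smul_zero]

theorem lamOrderLE_C_lam {σ : Type*} (i : ℤ) :
    LamOrderLE (MvPowerSeries.C (lam i) : MvPowerSeries σ (LaurentSeries K)) i := by
  classical
  intro M n hn
  rw [MvPowerSeries.coeff_C]
  split_ifs
  · exact HahnSeries.coeff_single_of_ne (by omega)
  · rfl

theorem LamOrderLE.res_eq_zero {σ : Type*} {F : MvPowerSeries σ (LaurentSeries K)} {d : ℤ}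
    (hF : LamOrderLE F d) (hd : d < -1) : res F = 0 := by
  ext M
  exact hF M 1 (by omega)

theorem _root_.ExtBKP.PDO.OrderLE.symbol {P : PDO (Fn K)} {d : ℤ} (hP : P.OrderLE d) :
    LamOrderLE (symbol P) d := fun M n hn => by
  rw [coeff_symbol, hP _ (by omega), map_zero]

theorem res_map_mul_C_lam {σ : Type*} (f : MvPowerSeries σ K) (i : ℤ) :
    res (MvPowerSeries.map HahnSeries.C f * MvPowerSeries.C (lam i)) = if i = -1 then f else 0 := by
  ext M
  rw [coeff_res, mul_comm, MvPowerSeries.coeff_C_mul, MvPowerSeries.coeff_map, lam,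
    HahnSeries.coeff_single_mul, one_mul, HahnSeries.C_apply]
  split_ifs with h
  · subst h; simp
  · rw [HahnSeries.coeff_single_of_ne (by omega), map_zero]

theorem symbol_monomial (i : ℤ) (a : Fn K) :
    symbol (PDO.monomial i a) = MvPowerSeries.C (lam i) * MvPowerSeries.map HahnSeries.C a := by
  rw [PDO.monomial_eq, symbol_mul_D, symbol_C]

/-- For `i ≥ 0` the operator `∂ⁱ b` is differential, and for `i < -1` its order is too low to have a
residue. -/
theorem coeff_neg_one_D_mul_C (i : ℤ) (b : Fn K) :
    (PDO.D i * PDO.C b : PDO (Fn K)).coeff (-1) = if i = -1 then b else 0 := by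
  rw [PDO.coeff_D_mul_C]
  by_cases h : i = -1
  · subst h; simp
  rw [if_neg h]
  split_ifs with h1
  · obtain ⟨m, rfl⟩ : ∃ m : ℕ, i = m := ⟨i.toNat, by omega⟩
    have h2 : ((m : ℤ) - -1).toNat = m + 1 := by omega
    have h3 := Ring.choose_natCast (R := ℤ) m (m + 1)
    rw [Nat.choose_succ_self] at h3
    rw [h2, h3, Nat.cast_zero, zero_smul]
  · rfl

/-- The residue in `λ` of a product of symbols is the residue of a product of operators. -/
theorem res_symbol_mul (P Q : PDO (Fn K)) :
    res (MvPowerSeries.C (lam (-1)) * (symbol P * negLam (symbol Q))) =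
      (P * PDO.D (-1) * Q.adjoint).coeff (-1) := by
  let φ : PDO (Fn K) → PDO (Fn K) → Fn K := fun P Q =>
    res (MvPowerSeries.C (lam (-1)) * (symbol P * negLam (symbol Q))) -
      (P * PDO.D (-1) * Q.adjoint).coeff (-1)
  -- Both residues vanish when the total order is negative, so each argument in turn can be reduced
  -- to monomials.
  have hord : ∀ (P Q : PDO (Fn K)) (d e : ℤ), P.OrderLE d → Q.OrderLE e → d + e < 0 →
      φ P Q = 0 := by
    intro P Q d e hP hQ h
    have h1 := ((lamOrderLE_C_lam (-1)).mul (hP.symbol.mul hQ.symbol.negLam)).res_eq_zero (by omega)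
    have h2 := (hP.mul (PDO.orderLE_D (-1))).mul hQ.adjoint (-1) (by omega)
    change _ - _ = _
    rw [h1, h2, sub_zero]
  have hmono : ∀ i a j b, φ (PDO.monomial i a) (PDO.monomial j b) = 0 := by
    intro i a j b
    change _ - _ = _
    have hn : negLam (MvPowerSeries.map HahnSeries.C b : MvPowerSeries Var (LaurentSeries K)) =
        MvPowerSeries.map HahnSeries.C b := by
      ext M n
      rw [negLam_eq, MvPowerSeries.coeff_map, coeff_negLamHom, MvPowerSeries.coeff_map,
        HahnSeries.C_apply]
      by_cases h : n = 0
      · subst h; simp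
      · rw [HahnSeries.coeff_single_of_ne h, smul_zero]
    -- For `a ∂ⁱ` and `b ∂ʲ` both sides equal `(-1)ʲ a b` if `i + j = 0` and vanish otherwise.
    have e1 : MvPowerSeries.C (lam (-1)) * (symbol (PDO.monomial i a) *
        negLam (symbol (PDO.monomial j b))) = (j.negOnePow : ℤ) •
        (MvPowerSeries.map HahnSeries.C (a * b) * MvPowerSeries.C (lam (i + -1 + j))) := by
      rw [symbol_monomial, symbol_monomial, negLam_mul, hn, negLam_eq, MvPowerSeries.map_C,
        negLamHom_lam, map_zsmul, map_mul, ← lam_mul_lam, ← lam_mul_lam, map_mul, map_mul]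
      simp only [zsmul_eq_mul]
      ring
    have e2 : PDO.monomial i a * PDO.D (-1) * (PDO.monomial j b).adjoint = (j.negOnePow : ℤ) •
        (PDO.C a * (PDO.D (i + -1 + j) * PDO.C b)) := by
      rw [PDO.monomial_eq, PDO.adjoint_monomial, mul_smul_comm, mul_assoc, mul_assoc,
        ← mul_assoc (PDO.D (-1)), PDO.D_mul_D, ← mul_assoc (PDO.D i), PDO.D_mul_D, add_assoc]
    rw [e1, e2, ← resHom_apply, map_zsmul, resHom_apply, res_map_mul_C_lam, PDO.coeff_zsmul,
      PDO.coeff_C_mul, coeff_neg_one_D_mul_C]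
    split_ifs <;> simp
  have hadd1 : ∀ P P' Q, φ (P + P') Q = φ P Q + φ P' Q := by
    intro P P' Q
    simp only [φ, symbol_add, add_mul, mul_add, res_add, PDO.coeff_add]
    ring
  have hadd2 : ∀ P Q Q', φ P (Q + Q') = φ P Q + φ P Q' := by
    intro P Q Q'
    simp only [φ, symbol_add, negLam_add, PDO.adjoint_add, mul_add, res_add, PDO.coeff_add]
    ring
  have h1 : ∀ i a Q, φ (PDO.monomial i a) Q = 0 := by
    intro i a Q
    obtain ⟨d, hd⟩ := (PDO.monomial i a).exists_orderLE
    exact PDO.addMonoidHom_eq_zero (AddMonoidHom.mk' (φ (PDO.monomial i a)) (hadd2 _)) (-d - 1)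
      (fun Q hQ => hord _ Q d _ hd hQ (by omega)) (hmono i a) Q
  obtain ⟨d, hd⟩ := Q.exists_orderLE
  exact sub_eq_zero.mp (PDO.addMonoidHom_eq_zero (AddMonoidHom.mk' (fun P => φ P Q)
    fun P P' => hadd1 P P' Q) (-d - 1) (fun P hP => hord P Q _ d hP hd (by omega))
    (fun i a => h1 i a Q) P)

/-- At equal times the two exponentials cancel, which leaves the symbols. -/
theorem res_actExp_mul [CharZero K] (P Q : PDO (Fn K)) :
    res (MvPowerSeries.C (lam (-1)) * (actExp P * negLam (actExp Q))) =
      (P * PDO.D (-1) * Q.adjoint).coeff (-1) := by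
  rw [← res_symbol_mul, actExp, actExp, negLam_mul, mul_mul_mul_comm, expXi_mul_negLam, mul_one]

end Spectral

/-! ### Shifted arguments and the diagonal -/

section Shift

variable (R : Type*) [CommRing R]

open MvPowerSeries

/-- The variables restricted to the diagonal `t' = t`. -/
def diagVar : BiVar → MvPowerSeries Var R
  | .z => X .z
  | .t n => X (.t n)
  | .t' n => X (.t n)

theorem hasSubst_diagVar : HasSubst (diagVar R) := by
  classical
  refine ⟨fun s => by cases s <;> simp [diagVar], fun d => ?_⟩
  let u : BiVar → Var
    | .z => .z
    | .t n => .t n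
    | .t' n => .t n
  have hu : ∀ s, diagVar R s = X (u s) := fun s => by cases s <;> rfl
  have hfin : ∀ v, (u ⁻¹' {v}).Finite := by
    intro v
    cases v with
    | z => exact (Set.finite_singleton BiVar.z).subset fun s hs => by cases s <;> simp_all [u]
    | t n =>
      exact (Set.toFinite {BiVar.t n, BiVar.t' n}).subset fun s hs => by cases s <;> simp_all [u]
  by_cases hd : ∃ v, d = Finsupp.single v 1
  · obtain ⟨v, rfl⟩ := hd
    refine (hfin v).subset fun s hs => ?_
    by_contra h
    refine hs ?_
    rw [hu, coeff_X, if_neg fun e => h ?_]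
    exact (Finsupp.single_left_injective one_ne_zero e).symm
  · refine Set.finite_empty.subset fun s hs => hs ?_
    rw [hu, coeff_X, if_neg fun e => hd ⟨_, e⟩]

variable {R}

/-- Restriction to the diagonal `t' = t`. -/
def diag (H : MvPowerSeries BiVar R) : MvPowerSeries Var R := subst (diagVar R) H

theorem diag_sub (F G : MvPowerSeries BiVar R) : diag (F - G) = diag F - diag G :=
  subst_sub (hasSubst_diagVar R) F G

theorem diag_mul (F G : MvPowerSeries BiVar R) : diag (F * G) = diag F * diag G :=
  subst_mul (hasSubst_diagVar R) F G

theorem diag_C (c : R) : diag (MvPowerSeries.C c) = MvPowerSeries.C c := subst_C c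

theorem pderiv_z_diag (H : MvPowerSeries BiVar R) :
    pderiv R .z (diag H) = diag (pderiv R .z H) := by
  rw [diag, pderiv_subst (hasSubst_diagVar R) _ {.z}]
  · simp [diagVar, diag]
  · intro s hs
    cases s <;> simp_all [diagVar, pderiv_X_of_ne]

theorem pderiv_t_diag (n : OddNat) (H : MvPowerSeries BiVar R) :
    pderiv R (.t n) (diag H) = diag (pderiv R (.t n) H) + diag (pderiv R (.t' n) H) := by
  classical
  rw [diag, pderiv_subst (hasSubst_diagVar R) _ {.t n, .t' n}]
  · rw [Finset.sum_pair (by simp)]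
    simp [diagVar, diag]
  · intro s hs
    simp only [Finset.mem_insert, Finset.mem_singleton, not_or] at hs
    cases s with
    | z => exact pderiv_X_of_ne (by simp)
    | t m => exact pderiv_X_of_ne fun h => hs.1 (by cases h; rfl)
    | t' m => exact pderiv_X_of_ne fun h => hs.2 (by cases h; rfl)

/-- Restriction to the diagonal preserves constant terms, since the substituted series have none. -/
theorem constantCoeff_eq_zero_of_diag {H : MvPowerSeries BiVar R} (h : diag H = 0) :
    constantCoeff H = 0 := by
  have h1 : constantCoeff (diag (H - MvPowerSeries.C (constantCoeff H))) = 0 :=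
    constantCoeff_subst_eq_zero (hasSubst_diagVar R) (fun s => by cases s <;> simp [diagVar])
      (by simp)
  rw [diag_sub, h, diag_C, zero_sub, map_neg, constantCoeff_C, neg_eq_zero] at h1
  exact h1

/-- Taylor expansion in `t` (or `t'`) about the diagonal: a set of power series closed under all
`∂/∂tₙ` (or all `∂/∂tₙ'`) and vanishing on the diagonal contains at most the zero series. -/
theorem eq_zero_of_diag_eq_zero [IsAddTorsionFree R] (S : Set (MvPowerSeries BiVar R))
    (hS : (∀ n, ∀ H ∈ S, pderiv R (.t n) H ∈ S) ∨ (∀ n, ∀ H ∈ S, pderiv R (.t' n) H ∈ S))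
    (hd : ∀ H ∈ S, diag H = 0) {H : MvPowerSeries BiVar R} (hH : H ∈ S) : H = 0 := by
  let ds : List BiVar → MvPowerSeries BiVar R → MvPowerSeries BiVar R :=
    fun l H => l.foldr (fun v X => pderiv R v X) H
  have hcomm : ∀ l v H, pderiv R v (ds l H) = ds l (pderiv R v H) := by
    intro l v H
    induction l with
    | nil => rfl
    | cons w l ih =>
      change pderiv R v (pderiv R w (ds l H)) = pderiv R w (ds l (pderiv R v H))
      rw [pderiv_pderiv_comm, ih]
  -- Along the diagonal `∂/∂tₙ` is the sum of the derivatives in `tₙ` and `tₙ'`. One of them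
  -- vanishes there because `S` is closed under it and partial derivatives commute, hence so does
  -- the other.
  have key : ∀ l, ∀ H ∈ S, diag (ds l H) = 0 := by
    intro l
    induction l with
    | nil => exact hd
    | cons v l ih =>
      intro H hH
      have hsum : ∀ n, diag (pderiv R (.t n) (ds l H)) + diag (pderiv R (.t' n) (ds l H)) = 0 :=
        fun n => by rw [← pderiv_t_diag, ih H hH, map_zero]
      have hboth : ∀ n, diag (pderiv R (.t n) (ds l H)) = 0 ∧
          diag (pderiv R (.t' n) (ds l H)) = 0 := by
        intro n
        rcases hS with hS | hS
        · have h1 : diag (pderiv R (.t n) (ds l H)) = 0 := by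
            rw [hcomm]
            exact ih _ (hS n H hH)
          have h2 := hsum n
          rw [h1, zero_add] at h2
          exact ⟨h1, h2⟩
        · have h1 : diag (pderiv R (.t' n) (ds l H)) = 0 := by
            rw [hcomm]
            exact ih _ (hS n H hH)
          have h2 := hsum n
          rw [h1, add_zero] at h2
          exact ⟨h2, h1⟩
      change diag (pderiv R v (ds l H)) = 0
      cases v with
      | z => rw [← pderiv_z_diag, ih H hH, map_zero]
      | t n => exact (hboth n).1
      | t' n => exact (hboth n).2
  refine eq_zero_of_pderiv_closed {X | ∃ l, ∃ H ∈ S, X = ds l H} ?_ ?_ ⟨[], H, hH, rfl⟩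
  · rintro v _ ⟨l, H, hH, rfl⟩
    exact ⟨v :: l, H, hH, rfl⟩
  · rintro _ ⟨l, H, hH, rfl⟩
    exact constantCoeff_eq_zero_of_diag (key l H hH)

variable (R) in
/-- The original flow `∂/∂tₙ`, in terms of the modified flow and the auxiliary flow. -/
def flowDeriv (k n : OddNat) : Derivation R (MvPowerSeries Var R) (MvPowerSeries Var R) :=
  pderiv R (.t n) - if n = k then pderiv R .z else 0

theorem flowDeriv_self (k : OddNat) (f : MvPowerSeries Var R) :
    flowDeriv R k k f = pderiv R (.t k) f - pderiv R .z f := by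
  rw [flowDeriv, if_pos rfl]; rfl

theorem flowDeriv_of_ne {k n : OddNat} (h : n ≠ k) (f : MvPowerSeries Var R) :
    flowDeriv R k n f = pderiv R (.t n) f := by
  rw [flowDeriv, if_neg h, sub_zero]

/-- In the chain rule the slot `z - t̄ₖ` contributes `-∂_z` exactly for `n = k`: the shift turns the
modified flow into the original one. -/
theorem pderiv_t_atT (k n : OddNat) (f : MvPowerSeries Var R) :
    pderiv R (.t n) (atT k f) = atT k (flowDeriv R k n f) := by
  classical
  have hs := hasSubst_shift R k
  rw [atT, pderiv_subst hs _ {.z, .t n}, Finset.sum_pair (by simp)]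
  · have h1 : pderiv R (.t n) (shift R k (.t n)) = 1 := pderiv_X_self
    have h2 : pderiv R (.t n) (shift R k .z) = if n = k then -1 else 0 := by
      rw [shift, map_sub, pderiv_X_of_ne (by simp), zero_sub]
      split_ifs with h
      · rw [h, pderiv_X_self]
      · rw [pderiv_X_of_ne (fun e => h (by cases e; rfl)), neg_zero]
    rw [h1, h2]
    by_cases h : n = k
    · subst h
      rw [flowDeriv_self, atT, subst_sub hs, if_pos rfl]
      ring
    · rw [flowDeriv_of_ne h, atT, if_neg h]
      ring
  · intro s hs
    simp only [Finset.mem_insert, Finset.mem_singleton, not_or] at hs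
    cases s with
    | z => exact absurd rfl hs.1
    | t m => exact pderiv_X_of_ne fun h => hs.2 (by cases h; rfl)

theorem pderiv_t'_atT' (k n : OddNat) (f : MvPowerSeries Var R) :
    pderiv R (.t' n) (atT' k f) = atT' k (flowDeriv R k n f) := by
  classical
  have hs := hasSubst_shift' R k
  rw [atT', pderiv_subst hs _ {.z, .t n}, Finset.sum_pair (by simp)]
  · have h1 : pderiv R (.t' n) (shift' R k (.t n)) = 1 := pderiv_X_self
    have h2 : pderiv R (.t' n) (shift' R k .z) = if n = k then -1 else 0 := by
      rw [shift', map_sub, pderiv_X_of_ne (by simp), zero_sub]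
      split_ifs with h
      · rw [h, pderiv_X_self]
      · rw [pderiv_X_of_ne (fun e => h (by cases e; rfl)), neg_zero]
    rw [h1, h2]
    by_cases h : n = k
    · subst h
      rw [flowDeriv_self, atT', subst_sub hs, if_pos rfl]
      ring
    · rw [flowDeriv_of_ne h, atT', if_neg h]
      ring
  · intro s hs
    simp only [Finset.mem_insert, Finset.mem_singleton, not_or] at hs
    cases s with
    | z => exact absurd rfl hs.1
    | t m => exact pderiv_X_of_ne fun h => hs.2 (by cases h; rfl)

theorem pderiv_t_atT' (k n : OddNat) (f : MvPowerSeries Var R) :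
    pderiv R (.t n) (atT' k f) = 0 := by
  rw [atT', pderiv_subst (hasSubst_shift' R k) _ ∅, Finset.sum_empty]
  intro s _
  cases s with
  | z => rw [shift', map_sub, pderiv_X_of_ne (by simp), pderiv_X_of_ne (by simp), sub_zero]
  | t m => exact pderiv_X_of_ne (by simp)

theorem pderiv_t'_atT (k n : OddNat) (f : MvPowerSeries Var R) :
    pderiv R (.t' n) (atT k f) = 0 := by
  rw [atT, pderiv_subst (hasSubst_shift R k) _ ∅, Finset.sum_empty]
  intro s _
  cases s with
  | z => rw [shift, map_sub, pderiv_X_of_ne (by simp), pderiv_X_of_ne (by simp), sub_zero]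
  | t m => exact pderiv_X_of_ne (by simp)

theorem atT_mul (k : OddNat) (f g : MvPowerSeries Var R) : atT k (f * g) = atT k f * atT k g :=
  subst_mul (hasSubst_shift R k) f g

theorem atT_sub (k : OddNat) (f g : MvPowerSeries Var R) : atT k (f - g) = atT k f - atT k g :=
  subst_sub (hasSubst_shift R k) f g

theorem atT_one (k : OddNat) : atT k (1 : MvPowerSeries Var R) = 1 := by
  rw [atT, ← coe_substAlgHom (hasSubst_shift R k), map_one]

theorem diag_atT' (k : OddNat) (f : MvPowerSeries Var R) : diag (atT' k f) = diag (atT k f) := by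
  rw [diag, diag, atT, atT', subst_comp_subst_apply (hasSubst_shift R k) (hasSubst_diagVar R),
    subst_comp_subst_apply (hasSubst_shift' R k) (hasSubst_diagVar R)]
  congr 1
  funext s
  cases s with
  | z => simp only [shift, shift', subst_sub (hasSubst_diagVar R), subst_X (hasSubst_diagVar R),
      diagVar]
  | t n => simp only [shift, shift', subst_X (hasSubst_diagVar R), diagVar]

end Shift

/-! ### Residues of products in two sets of times -/

section Residue

variable {K : Type*} [Field K]

theorem res_diag (F : MvPowerSeries BiVar (LaurentSeries K)) : res (diag F) = diag (res F) := by
  rw [diag, diag, ← res_subst (hasSubst_diagVar K)]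
  congr 2
  funext s
  cases s <;> exact (MvPowerSeries.map_X _ _).symm

theorem res_atT (k : OddNat) (F : MvPowerSeries Var (LaurentSeries K)) :
    res (atT k F) = atT k (res F) := by
  rw [atT, atT, ← res_subst (hasSubst_shift K k)]
  congr 2
  funext s
  cases s <;> simp [shift]

theorem diag_res₂ (k : OddNat) (F G : MvPowerSeries Var (LaurentSeries K)) :
    diag (res₂ (atT k F) (atT' k G)) =
      diag (atT k (res (MvPowerSeries.C (lam (-1)) * (F * G)))) := by
  have hC : (MvPowerSeries.C (lam (-1)) : MvPowerSeries BiVar (LaurentSeries K)) =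
      atT k (MvPowerSeries.C (lam (-1))) := (MvPowerSeries.subst_C _).symm
  rw [res₂, ← res_diag, diag_mul, diag_atT', ← diag_mul, res_diag, hC, ← atT_mul, ← atT_mul,
    res_atT, mul_assoc]

theorem pderiv_res₂ (v : BiVar) (F G : MvPowerSeries BiVar (LaurentSeries K)) :
    MvPowerSeries.pderiv K v (res₂ F G) =
      res₂ (MvPowerSeries.pderiv _ v F) G + res₂ F (MvPowerSeries.pderiv _ v G) := by
  rw [res₂, ← res_pderiv, mul_assoc, Derivation.leibniz, Derivation.leibniz,
    MvPowerSeries.pderiv_C, smul_zero, add_zero, res₂, res₂, ← res_add]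
  simp only [smul_eq_mul]
  congr 1
  ring

theorem pderiv_t_res₂ (k n : OddNat) (F G : MvPowerSeries Var (LaurentSeries K)) :
    MvPowerSeries.pderiv K (.t n) (res₂ (atT k F) (atT' k G)) =
      res₂ (atT k (flowDeriv _ k n F)) (atT' k G) := by
  rw [pderiv_res₂, pderiv_t_atT, pderiv_t_atT', add_eq_left, res₂, mul_zero]
  rfl

theorem pderiv_t'_res₂ (k n : OddNat) (F G : MvPowerSeries Var (LaurentSeries K)) :
    MvPowerSeries.pderiv K (.t' n) (res₂ (atT k F) (atT' k G)) =
      res₂ (atT k F) (atT' k (flowDeriv _ k n G)) := by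
  rw [pderiv_res₂, pderiv_t'_atT', pderiv_t'_atT, add_eq_right, res₂, mul_zero, zero_mul]
  rfl

end Residue

/-! ### Differential operators -/

namespace PDO

/-- `P` is a differential operator. -/
def IsDiff {A : Type*} [Zero A] (P : PDO A) : Prop := ∀ i, i < 0 → P.coeff i = 0

variable {A : Type*} [CommRing A]

theorem isDiff_pos (P : PDO A) : P.pos.IsDiff := fun _ hi => if_neg (by omega)

theorem pos_add_neg (P : PDO A) : P.pos + P.neg = P := by
  ext i
  change (if 0 ≤ i then P.coeff i else 0) + (if i < 0 then P.coeff i else 0) = _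
  by_cases h : 0 ≤ i
  · rw [if_pos h, if_neg (by omega), add_zero]
  · rw [if_neg h, if_pos (by omega), zero_add]

theorem isDiff_C (a : A) : (C a).IsDiff := fun i hi => by rw [coeff_C, if_neg (by omega)]

theorem isDiff_one : (1 : PDO A).IsDiff := isDiff_C 1

theorem IsDiff.add {P Q : PDO A} (hP : P.IsDiff) (hQ : Q.IsDiff) : (P + Q).IsDiff :=
  fun i hi => by rw [coeff_add, hP i hi, hQ i hi, add_zero]

theorem IsDiff.mapCoeff {P : PDO A} (hP : P.IsDiff) (δ : A →+ A) : (mapCoeff δ P).IsDiff :=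
  fun i hi => by rw [coeff_mapCoeff, hP i hi, map_zero]

variable [Differential A]

/-- A negative total exponent would need `l > i` with `i ≥ 0`, where `(i choose l) = 0`. -/
theorem IsDiff.mul {P Q : PDO A} (hP : P.IsDiff) (hQ : Q.IsDiff) : (P * Q).IsDiff := by
  intro n hn
  rw [coeff_mul]
  refine finsum_eq_zero_of_forall_eq_zero fun p => ?_
  by_cases h1 : p.1 < 0
  · rw [hP _ h1, zero_mul, smul_zero]
  by_cases h2 : n + p.2 - p.1 < 0
  · rw [hQ _ h2, iterDeriv_zero, mul_zero, smul_zero]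
  obtain ⟨m, hm⟩ : ∃ m : ℕ, p.1 = m := ⟨p.1.toNat, by omega⟩
  have h3 := Ring.choose_natCast (R := ℤ) m p.2
  rw [Nat.choose_eq_zero_of_lt (by omega)] at h3
  rw [hm, h3, Nat.cast_zero, zero_smul]

/-- The action of a differential operator on a function is the constant term of a composition. -/
theorem apply_eq_coeff (P : PDO A) (f : A) : P.apply f = (P * C f).coeff 0 := by
  have hinj : Function.Injective fun l : ℕ => ((l : ℤ), l) := fun l m h => (Prod.ext_iff.mp h).2
  rw [coeff_mul, ← finsum_mem_univ,
    finsum_mem_inter_support_eq _ _ (Set.range fun l : ℕ => ((l : ℤ), l)), finsum_mem_range hinj]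
  · refine finsum_congr fun l => ?_
    have h3 := Ring.choose_natCast (R := ℤ) l l
    rw [Nat.choose_self] at h3
    simp only
    rw [h3, coeff_C, if_pos (by omega), Nat.cast_one, one_smul]
  · ext ⟨i, l⟩
    simp only [Set.univ_inter, Function.mem_support, Set.mem_inter_iff, Set.mem_range]
    refine ⟨fun h => ⟨⟨l, ?_⟩, h⟩, fun h => h.2⟩
    by_contra hil
    refine h ?_
    rw [coeff_C, if_neg fun e => hil (Prod.ext (by simp only; omega) rfl), iterDeriv_zero, mul_zero,
      smul_zero]

/-- The constant term of `P Q` is `P` applied to the constant term of `Q`. -/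
theorem IsDiff.coeff_zero_mul {P Q : PDO A} (hP : P.IsDiff) (hQ : Q.IsDiff) :
    (P * Q).coeff 0 = (P * C (Q.coeff 0)).coeff 0 := by
  -- Write `Q = Q₀ + R ∂` with `R` differential; then `P R ∂` has no constant term.
  have hR : ((Q - C (Q.coeff 0)) * D (-1)).IsDiff := by
    intro i hi
    rw [coeff_mul_D, coeff_sub, coeff_C]
    by_cases h : i = -1
    · subst h; simp
    · rw [hQ _ (by omega), if_neg (by omega), sub_zero]
  have hQ' : Q = C (Q.coeff 0) + (Q - C (Q.coeff 0)) * D (-1) * D 1 := by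
    rw [mul_assoc, D_mul_D, neg_add_cancel, D_zero, mul_one, add_sub_cancel]
  conv_lhs => rw [hQ', mul_add, ← mul_assoc, coeff_add, coeff_mul_D]
  rw [hP.mul hR (0 - 1) (by omega), add_zero]

/-- The residue of `∂⁻¹ f P*` is `P` applied to `f`. -/
theorem coeff_neg_one_D_C_adjoint (P : PDO A) (f : A) :
    (D (-1) * C f * P.adjoint).coeff (-1) = (P * C f).coeff 0 := by
  -- Up to sign the two operators are adjoint to each other, and the residue changes sign under the
  -- adjoint.
  have h : (P * C f * D (-1)).adjoint = -(D (-1) * C f * P.adjoint) := by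
    rw [adjoint_mul, adjoint_mul, adjoint_C, adjoint_D, Int.negOnePow_neg, Int.negOnePow_one,
      Units.val_neg, Units.val_one, neg_smul, one_smul, neg_mul, mul_assoc]
  have h1 := coeff_neg_one_adjoint (P * C f * D (-1))
  rw [h, coeff_neg, neg_inj, coeff_mul_D] at h1
  simpa using h1

end PDO

/-! ### Dressing operators -/

section Dressing

variable {K : Type*} [Field K]

open PDO

/-- The commutator `q′ = ∂ q - q ∂`, multiplied by `∂⁻¹` on both sides. -/
theorem D_neg_one_C_deriv_D_neg_one (q : Fn K) :
    (D (-1) * C (q′) * D (-1) : PDO (Fn K)) = C q * D (-1) - D (-1) * C q := by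
  have h : (C (q′) : PDO (Fn K)) = D 1 * C q - C q * D 1 := by
    have h1 : mapCoeff derivHom (C q) = C (q′) := by
      ext1
      funext i
      rw [coeff_mapCoeff, coeff_C, coeff_C]
      split_ifs
      · rfl
      · exact map_zero _
    rw [D_one_mul, h1, add_sub_cancel_right]
  rw [h, mul_sub, sub_mul, ← mul_assoc, D_mul_D, neg_add_cancel, D_zero, one_mul, ← mul_assoc,
    mul_assoc _ (D 1), D_mul_D, add_neg_cancel, D_zero, mul_one]

/-- The terms `r q ∂⁻¹` cancel; what remains is the antisymmetric kernel behind the right-hand side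
of the second identity. -/
theorem source_mul_D_neg_one (q r : Fn K) :
    source q r * D (-1) = C q * D (-1) * C r - C r * D (-1) * C q := by
  have h : source q r = C r * (D (-1) * C (q′)) - C q * (D (-1) * C (r′)) := by
    rw [source, mul_assoc, mul_assoc]
  rw [h, sub_mul, mul_assoc (C r), mul_assoc (C q), D_neg_one_C_deriv_D_neg_one,
    D_neg_one_C_deriv_D_neg_one, mul_sub, mul_sub, ← mul_assoc (C r), ← mul_assoc (C r),
    ← mul_assoc (C q), ← mul_assoc (C q), C_mul_C, C_mul_C, mul_comm q r]
  abel

variable {k : OddNat} {L W : PDO (Fn K)} {q r : Fn K}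

/-- The flow derivation on the coefficients of an operator. -/
def flowCoeff (k n : OddNat) : PDO (Fn K) → PDO (Fn K) :=
  mapCoeff (AddMonoidHomClass.toAddMonoidHom (flowDeriv K k n))

theorem flowCoeff_mul (n : OddNat) (P Q : PDO (Fn K)) :
    flowCoeff k n (P * Q) = flowCoeff k n P * Q + P * flowCoeff k n Q := by
  refine mapCoeff_mul _ (fun a b => ?_) (fun a => ?_) P Q
  · change flowDeriv K k n (a * b) = flowDeriv K k n a * b + a * flowDeriv K k n b
    rw [Derivation.leibniz, smul_eq_mul, smul_eq_mul]
    ring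
  · change flowDeriv K k n (MvPowerSeries.pderiv K Var.x a) =
      MvPowerSeries.pderiv K Var.x (flowDeriv K k n a)
    by_cases h : n = k
    · subst h
      rw [flowDeriv_self, flowDeriv_self, map_sub, pderiv_pderiv_comm, pderiv_pderiv_comm Var.z]
    · rw [flowDeriv_of_ne h, flowDeriv_of_ne h, pderiv_pderiv_comm]

theorem flowCoeff_self (P : PDO (Fn K)) : flowCoeff k k P = P.dvar (.t k) - P.dvar .z := by
  ext1
  funext i
  rw [coeff_sub]
  exact flowDeriv_self k _

theorem flowCoeff_of_ne {n : OddNat} (h : n ≠ k) (P : PDO (Fn K)) :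
    flowCoeff k n P = P.dvar (.t n) := by
  ext1
  funext i
  exact flowDeriv_of_ne h _

theorem flowDeriv_coeff (n : OddNat) (P : PDO (Fn K)) (i : ℤ) :
    flowDeriv K k n (P.coeff i) = (flowCoeff k n P).coeff i := rfl

theorem flowCoeff_C (n : OddNat) (f : Fn K) : flowCoeff k n (C f) = C (flowDeriv K k n f) := by
  ext1
  funext i
  rw [← flowDeriv_coeff, coeff_C, coeff_C]
  split_ifs
  · rfl
  · exact map_zero _

theorem flowDeriv_actExp [CharZero K] (n : OddNat) (P : PDO (Fn K)) :
    flowDeriv (LaurentSeries K) k n (actExp P) = actExp (flowCoeff k n P + P * D (n : ℕ)) := by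
  by_cases h : n = k
  · subst h
    rw [flowDeriv_self, pderiv_t_actExp, pderiv_z_actExp, ← actExp_sub, flowCoeff_self]
    congr 1
    abel
  · rw [flowDeriv_of_ne h, pderiv_t_actExp, flowCoeff_of_ne h]

theorem flowDeriv_negLam [CharZero K] (n : OddNat) (F : MvPowerSeries Var (LaurentSeries K)) :
    flowDeriv (LaurentSeries K) k n (negLam F) = negLam (flowDeriv (LaurentSeries K) k n F) := by
  by_cases h : n = k
  · subst h
    rw [flowDeriv_self, flowDeriv_self, negLam_sub, pderiv_negLam, pderiv_negLam]
  · rw [flowDeriv_of_ne h, flowDeriv_of_ne h, pderiv_negLam]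

/-! ### Flows and constraint of the dressing operator -/

namespace IsDressing

theorem pow_mul (hW : IsDressing k L q r W) (n : ℕ) : L ^ n * W = W * D (n : ℤ) := by
  obtain ⟨V, h1, h2, h3⟩ := hW.dress
  induction n with
  | zero => rw [_root_.pow_zero, one_mul, Nat.cast_zero, D_zero, mul_one]
  | succ n ih =>
    rw [_root_.pow_succ, mul_assoc]
    conv_lhs => rw [h3, mul_assoc _ V, h2, mul_one, ← h3, ← mul_assoc, ih]
    rw [mul_assoc, D_mul_D, Nat.cast_succ]

/-- The constraint solved for `W* = ∂ W⁻¹ ∂⁻¹`. -/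
theorem mul_D_neg_one_adjoint (hW : IsDressing k L q r W) :
    W * D (-1) * W.adjoint = D (-1) := by
  obtain ⟨V, h1, h2, h3⟩ := hW.dress
  have h4 : W.adjoint = D 1 * V * D (-1) := by
    rw [← hW.constraint, mul_assoc _ W, h1, mul_one, mul_assoc, D_mul_D, add_neg_cancel, D_zero,
      mul_one]
  rw [h4, mul_assoc, ← mul_assoc (D (-1)), ← mul_assoc (D (-1)), D_mul_D, neg_add_cancel, D_zero,
    one_mul, ← mul_assoc, h1, one_mul]

/-- The flow of the dressing operator. -/
theorem flowCoeff_add (hW : IsDressing k L q r W) (n : OddNat) :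
    flowCoeff k n W + W * D (n : ℕ) = B L n * W := by
  have h : flowCoeff k n W = -(PDO.neg (L ^ (n : ℕ)) * W) := by
    by_cases h : n = k
    · subst h
      -- The source terms of the modified and the auxiliary flow cancel here.
      rw [flowCoeff_self, hW.flow_k, hW.flow_z, add_sub_cancel_right]
    · rw [flowCoeff_of_ne h, hW.flow_n n h]
  rw [h, ← hW.pow_mul, neg_add_eq_sub, ← sub_mul, B]
  congr 1
  rw [sub_eq_iff_eq_add, pos_add_neg]

/-- The constant term is the residue of `Lⁿ ∂⁻¹ = W ∂ⁿ⁻¹ W*`, self-adjoint as `n - 1` is even; being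
equal to its own negative, it vanishes in characteristic zero. -/
theorem coeff_zero_pow [CharZero K] (hW : IsDressing k L q r W) (n : OddNat) :
    (L ^ (n : ℕ)).coeff 0 = 0 := by
  have h1 : L ^ (n : ℕ) * D (-1) = W * D ((n : ℕ) - 1) * W.adjoint := by
    rw [← hW.mul_D_neg_one_adjoint, ← mul_assoc, ← mul_assoc, hW.pow_mul, mul_assoc W, D_mul_D,
      sub_eq_add_neg]
  have h2 : (L ^ (n : ℕ) * D (-1)).adjoint = L ^ (n : ℕ) * D (-1) := by
    have he : Even (((n : ℕ) : ℤ) - 1) := by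
      have := n.2
      rw [← Int.odd_coe_nat] at this
      exact this.sub_odd odd_one
    rw [h1, adjoint_mul, adjoint_mul, adjoint_adjoint, adjoint_D, Int.negOnePow_even _ he,
      Units.val_one, one_smul, mul_assoc]
  have h3 := coeff_neg_one_adjoint (L ^ (n : ℕ) * D (-1))
  rw [h2, coeff_mul_D] at h3
  have h4 : (2 : K) ≠ 0 := two_ne_zero
  ext M
  have h5 := congrArg (MvPowerSeries.coeff M) h3
  rw [map_neg, eq_neg_iff_add_eq_zero, ← two_mul] at h5
  simpa using h5

theorem coeff_zero_B [CharZero K] (hW : IsDressing k L q r W) (n : OddNat) :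
    (B L n).coeff 0 = 0 := by
  rw [← hW.coeff_zero_pow n]
  change (if (0 : ℤ) ≤ 0 then (L ^ (n : ℕ)).coeff 0 else 0) = _
  rw [if_pos le_rfl]

/-- A flow of `P w` is again an operator applied to `w`. This gives the closure required for the
Taylor expansion. -/
theorem flowDeriv_actExp_mul [CharZero K] (hW : IsDressing k L q r W) (n : OddNat)
    (P : PDO (Fn K)) : flowDeriv (LaurentSeries K) k n (actExp (P * W)) =
      actExp ((flowCoeff k n P + P * B L n) * W) := by
  rw [flowDeriv_actExp, flowCoeff_mul, add_mul, mul_assoc P (B L n), ← hW.flowCoeff_add, mul_add,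
    add_assoc, mul_assoc]

end IsDressing

/-- `f` is an eigenfunction of all flows. -/
def IsEigenfunction (k : OddNat) (L : PDO (Fn K)) (f : Fn K) : Prop :=
  ∀ n, flowDeriv K k n f = (B L n * C f).coeff 0

theorem IsExtendedBKP.isEigenfunction_q (hL : IsExtendedBKP k L q r) : IsEigenfunction k L q := by
  intro n
  rw [← apply_eq_coeff]
  by_cases h : n = k
  · subst h
    rw [flowDeriv_self, hL.q_k]
  · rw [flowDeriv_of_ne h, hL.q_n n h]

theorem IsExtendedBKP.isEigenfunction_r (hL : IsExtendedBKP k L q r) : IsEigenfunction k L r := by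
  intro n
  rw [← apply_eq_coeff]
  by_cases h : n = k
  · subst h
    rw [flowDeriv_self, hL.r_k]
  · rw [flowDeriv_of_ne h, hL.r_n n h]

theorem IsDressing.isEigenfunction_one [CharZero K] (hW : IsDressing k L q r W) :
    IsEigenfunction k L (1 : Fn K) := by
  intro n
  rw [C_one, mul_one, hW.coeff_zero_B, Derivation.map_one_eq_zero]

/-- The action of differential operators on an eigenfunction is compatible with the flows. -/
theorem IsEigenfunction.flowDeriv_apply {f : Fn K} (hf : IsEigenfunction k L f) (n : OddNat)
    {P : PDO (Fn K)} (hP : P.IsDiff) : flowDeriv K k n ((P * C f).coeff 0) =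
      ((flowCoeff k n P + P * B L n) * C f).coeff 0 := by
  rw [flowDeriv_coeff, flowCoeff_mul, flowCoeff_C, hf n, add_mul, coeff_add, coeff_add,
    mul_assoc, hP.coeff_zero_mul (Q := B L n * C f) ((isDiff_pos _).mul (isDiff_C f))]

theorem isDiff_flow {P : PDO (Fn K)} (hP : P.IsDiff) (n : OddNat) :
    (flowCoeff k n P + P * B L n).IsDiff :=
  (hP.mapCoeff _).add (hP.mul (isDiff_pos _))

/-- The bilinear identity of an eigenfunction. -/
theorem IsEigenfunction.bilinear [CharZero K] {f : Fn K} (hf : IsEigenfunction k L f)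
    (hW : IsDressing k L q r W) :
    atT k f = res₂ (atT k (wave W)) (atT' k (negLam (invDx f W))) := by
  -- `P` acts on the unprimed factors only; `P = 1` is the identity sought.
  let S : Set (MvPowerSeries BiVar K) := {H | ∃ P : PDO (Fn K), P.IsDiff ∧
    H = atT k ((P * C f).coeff 0) -
      res₂ (atT k (actExp (P * W))) (atT' k (negLam (invDx f W)))}
  have h1 : atT k f - res₂ (atT k (wave W)) (atT' k (negLam (invDx f W))) ∈ S :=
    ⟨1, isDiff_one, by rw [one_mul, one_mul, coeff_C, if_pos rfl, wave]⟩
  refine sub_eq_zero.mp (eq_zero_of_diag_eq_zero S (Or.inl ?_) ?_ h1)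
  · rintro n _ ⟨P, hP, rfl⟩
    exact ⟨_, isDiff_flow hP n, by
      rw [map_sub, pderiv_t_atT, pderiv_t_res₂, hf.flowDeriv_apply n hP,
        hW.flowDeriv_actExp_mul]⟩
  · rintro _ ⟨P, hP, rfl⟩
    have h2 : P * W * D (-1) * (D (-1) * C f * D 1 * W).adjoint = P * C f * D (-1) := by
      -- The signs of `∂* = -∂` and `(∂⁻¹)* = -∂⁻¹` cancel.
      have h3 : (D (-1) * C f * D 1 * W).adjoint = W.adjoint * (D 1 * (C f * D (-1))) := by
        rw [adjoint_mul, adjoint_mul, adjoint_mul, adjoint_C, adjoint_D, adjoint_D,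
          Int.negOnePow_neg, Int.negOnePow_one, Units.val_neg, Units.val_one, neg_smul, neg_smul,
          one_smul, one_smul, mul_neg, neg_mul_neg]
      rw [h3, mul_assoc P, mul_assoc P, ← mul_assoc (W * D (-1)), hW.mul_D_neg_one_adjoint,
        ← mul_assoc (D (-1)), D_mul_D, neg_add_cancel, D_zero, one_mul, mul_assoc]
    rw [diag_sub, diag_res₂, invDx, res_actExp_mul, h2, coeff_mul_D, neg_sub_neg, sub_self,
      sub_self]

/-- Here `P` acts in the primed times. In the unprimed ones `w_z` already carries the source
operator, which is not in general differential, so the family there would not fit. -/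
theorem IsDressing.bilinear_pderiv_z [CharZero K] (hW : IsDressing k L q r W)
    (hq : IsEigenfunction k L q) (hr : IsEigenfunction k L r) :
    res₂ (atT k (MvPowerSeries.pderiv (LaurentSeries K) .z (wave W))) (atT' k (negLam (wave W))) =
      atT k q * atT' k r - atT k r * atT' k q := by
  let S : Set (MvPowerSeries BiVar K) := {H | ∃ P : PDO (Fn K), P.IsDiff ∧
    H = res₂ (atT k (actExp (source q r * W))) (atT' k (negLam (actExp (P * W)))) -
      (atT k q * atT' k ((P * C r).coeff 0) - atT k r * atT' k ((P * C q).coeff 0))}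
  have h1 : res₂ (atT k (MvPowerSeries.pderiv (LaurentSeries K) .z (wave W)))
      (atT' k (negLam (wave W))) - (atT k q * atT' k r - atT k r * atT' k q) ∈ S :=
    ⟨1, isDiff_one, by
      rw [one_mul, one_mul, one_mul, coeff_C, coeff_C, if_pos rfl, if_pos rfl, wave,
        pderiv_z_actExp, hW.flow_z]⟩
  refine sub_eq_zero.mp (eq_zero_of_diag_eq_zero S (Or.inr ?_) ?_ h1)
  · rintro n _ ⟨P, hP, rfl⟩
    refine ⟨flowCoeff k n P + P * B L n, isDiff_flow hP n, ?_⟩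
    rw [map_sub, map_sub, pderiv_t'_res₂, flowDeriv_negLam, hW.flowDeriv_actExp_mul,
      Derivation.leibniz, Derivation.leibniz, pderiv_t'_atT, pderiv_t'_atT, pderiv_t'_atT',
      pderiv_t'_atT', hr.flowDeriv_apply n hP, hq.flowDeriv_apply n hP]
    simp only [smul_eq_mul, mul_zero, add_zero]
  · rintro _ ⟨P, hP, rfl⟩
    have h2 : source q r * W * D (-1) * (P * W).adjoint =
        C q * (D (-1) * C r * P.adjoint) - C r * (D (-1) * C q * P.adjoint) := by
      rw [adjoint_mul, mul_assoc (source q r), mul_assoc (source q r), ← mul_assoc (W * D (-1)),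
        hW.mul_D_neg_one_adjoint, ← mul_assoc, source_mul_D_neg_one, sub_mul]
      simp only [mul_assoc]
    rw [diag_sub, diag_sub, diag_mul, diag_mul, diag_atT', diag_atT', diag_res₂, res_actExp_mul,
      h2, coeff_sub, coeff_C_mul, coeff_C_mul, coeff_neg_one_D_C_adjoint,
      coeff_neg_one_D_C_adjoint, ← diag_mul, ← diag_mul, ← diag_sub, ← atT_mul, ← atT_mul,
      atT_sub, sub_self]

theorem invDx_one (W : PDO (Fn K)) : invDx 1 W = wave W := by
  rw [invDx, C_one, mul_one, D_mul_D, neg_add_cancel, D_zero, one_mul, wave]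

end Dressing

end ExtBKP

end

open ExtBKP
theorem mainTheorem2 {K : Type*} [Field K] [CharZero K] (k : OddNat) (hk : (k : ℕ) ≠ 1)
    (L : PDO (Fn K)) (q r : Fn K) (hL : IsExtendedBKP k L q r)
    (W : PDO (Fn K)) (hW : IsDressing k L q r W) :
    res₂ (atT k (wave W)) (atT' k (negLam (wave W))) = 1 ∧
    res₂ (atT k (MvPowerSeries.pderiv (LaurentSeries K) .z (wave W))) (atT' k (negLam (wave W))) =
      atT k q * atT' k r - atT k r * atT' k q ∧
    atT k q = res₂ (atT k (wave W)) (atT' k (negLam (invDx q W))) ∧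
    atT k r = res₂ (atT k (wave W)) (atT' k (negLam (invDx r W))) := by
  refine ⟨?_, hW.bilinear_pderiv_z hL.isEigenfunction_q hL.isEigenfunction_r,
    hL.isEigenfunction_q.bilinear hW, hL.isEigenfunction_r.bilinear hW⟩
  -- The first identity is the eigenfunction identity for the constant `1`.
  rw [← atT_one k, hW.isEigenfunction_one.bilinear hW, invDx_one]
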